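/- Let $k$ be an algebraically closed field of characteristic zero, $R=k[x_1,\dots,x_n]$ and $S=k[y_1,\dots,y_n]$ with their standard gradings, and let $R$ act on $S$ by $u\cdot F=u(\partial/\partial y_1,\dots,\partial/\partial y_n)F$. For a homogeneous ideal $J\subseteq R$ put $J^{-1}=\{F\in S: u\cdot F=0\text{ for all }u\in J\}$, a graded $R$-submodule of $S$. Let $I\subseteq R$ be a homogeneous ideal such that $A=R/I$ is an artin level algebra of socle degree $d$ and type $t$, that is, $A_d\neq 0$, $A_i=0$ for $i>d$, $\{a\in A: ax_j=0\text{ for all }j\}=A_d$ and $\dim_k A_d=t$. Let $\underline h=(h_i)$, $h_i=\dim_k A_i$, be its Hilbert function, and let $\Lambda=(I^{-1})_d\subseteq S_d$. Let $G(t,S_d)$ be the Grassmannian of $t$-dimensional subspaces of $S_d$, with tautological subbundle $\mathcal B\subseteq S_d\otimes\mathcal O$, and for $1\le i\le d-1$ let $\phi_i:R_{d-i}\otimes\mathcal B\to S_i\otimes\mathcal O$ be the map induced by the action. Let $\mathcal L^\circ(\underline h)\subseteq G(t,S_d)$ be the scheme-theoretic intersection over $1\le i\le d-1$ of the locally closed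 subschemes $\{\operatorname{rank}\phi_i\le h_i\}\setminus\{\operatorname{rank}\phi_i\le h_i-1\}$, where $\{\operatorname{rank}\phi_i\le r\}$ is defined by the vanishing of the $(r+1)\times(r+1)$ minors of $\phi_i$. Via the isomorphism $G(t,S_d)\simeq G(\dim R_d-t,R_d)$, $N\mapsto N^\perp$, given by the apolarity pairing $R_d\times S_d\to k$, regard $\mathcal L^\circ(\underline h)$ also as a subscheme of $G(\dim R_d-t,R_d)$. Recall the canonical isomorphism $T_{G,W}=\mathrm{Hom}_k(W,U/W)$ for the tangent space at $W\subseteq U$ of a Grassmannian $G$ of subspaces of $U$. The subscript $0$ denotes homomorphisms of graded modules of degree $0$. (A) $\Lambda$ is a point of $\mathcal L^\circ(\underline h)\subseteq G(t,S_d)$. Taking degree $d$ components defines an injection $\mathrm{Hom}_R(I^{-1},S/I^{-1})_0\hookrightarrow\mathrm{Hom}_k(\Lambda,S_d/\Lambda)=T_{G(t,S_d),\Lambda}$, and its image is the Zariski tangent space $T_{\mathcal L^\circ(\underline h),\Lambda}$. Moreover, the inclusion $(I^2)^{-1}/I^{-1}\subseteq S/I^{-1}$ induces an isomorphism $\mathrm{Hom}_R(I^{-1},(I^2)^{-1}/I^{-1})_0\simeq\mathrm{Hom}_R(I^{-1},S/I^{-1})_0$.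 Thus canonically $$T_{\mathcal L^\circ(\underline h),\Lambda}=\mathrm{Hom}_R(I^{-1},S/I^{-1})_0=\mathrm{Hom}_R(I^{-1},(I^2)^{-1}/I^{-1})_0 .$$ (B) $I_d$ is a point of $\mathcal L^\circ(\underline h)\subseteq G(\dim R_d-t,R_d)$. Taking degree $d$ components defines an injection $\mathrm{Hom}_R(I,R/I)_0\hookrightarrow\mathrm{Hom}_k(I_d,R_d/I_d)=T_{G(\dim R_d-t,R_d),I_d}$, and its image is the Zariski tangent space $T_{\mathcal L^\circ(\underline h),I_d}$. Moreover, the projection $I\to I/I^2$ induces an isomorphism $\mathrm{Hom}_R(I/I^2,R/I)_0\simeq\mathrm{Hom}_R(I,R/I)_0$. Thus canonically $$T_{\mathcal L^\circ(\underline h),I_d}=\mathrm{Hom}_R(I,R/I)_0=\mathrm{Hom}_R(I/I^2,R/I)_0 .$$ -/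

import Mathlib

namespace LevelAlgebra

noncomputable section

open MvPolynomial TensorProduct CategoryTheory
open scoped IsMulCommutative

universe u

/-- The ring `R = k[x₁, …, xₙ]`. -/
abbrev PolyR (n : ℕ) (k : Type u) [Field k] : Type u := MvPolynomial (Fin n) k

/-- The graded `k`-vector space underlying `S = k[y₁, …, yₙ]`. It is a type synonym, because `R`
acts on it by differentiation and not by multiplication. -/
def PolyS (n : ℕ) (k : Type u) [Field k] : Type u := MvPolynomial (Fin n) k

section Basic

variable (n : ℕ) (k : Type u) [Field k]

instance : AddCommGroup (PolyS n k) := inferInstanceAs (AddCommGroup (MvPolynomial (Fin n) k))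

instance : Module k (PolyS n k) := inferInstanceAs (Module k (MvPolynomial (Fin n) k))

/-- An element of `S`, regarded as a polynomial in `y₁, …, yₙ`. -/
def toPoly : PolyS n k ≃ₗ[k] MvPolynomial (Fin n) k := LinearEquiv.refl k _

/-- The operator `∂/∂yᵢ` on `S`. -/
def partialS (i : Fin n) : Module.End k (PolyS n k) :=
  (toPoly n k).symm.toLinearMap ∘ₗ (pderiv i).toLinearMap ∘ₗ (toPoly n k).toLinearMap

theorem partialS_comm (i j : Fin n) :
    partialS n k i * partialS n k j = partialS n k j * partialS n k i := by
  have h : ⁅(pderiv i : Derivation k (MvPolynomial (Fin n) k) _), pderiv j⁆ = 0 :=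
    derivation_ext fun l => by
      classical
      rw [Derivation.commutator_apply, pderiv_X, pderiv_X]
      by_cases hi : i = l <;> by_cases hj : j = l <;> simp [hi, hj, eq_comm]
  refine LinearMap.ext fun F => ?_
  have := congrArg (fun D => D (toPoly n k F)) h
  rw [Derivation.commutator_apply] at this
  exact sub_eq_zero.mp this

/-- The commutative algebra of constant coefficient differential operators on `S`. -/
def diffAlg : Subalgebra k (Module.End k (PolyS n k)) :=
  Algebra.adjoin k (Set.range (partialS n k))

instance : IsMulCommutative (diffAlg n k) :=
  Algebra.isMulCommutative_adjoin k (by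
    rintro _ ⟨i, rfl⟩ _ ⟨j, rfl⟩
    exact partialS_comm n k i j)

/-- The algebra map `u(x) ↦ u(∂/∂y₁, …, ∂/∂yₙ)`. -/
def diffOp : PolyR n k →ₐ[k] Module.End k (PolyS n k) :=
  (diffAlg n k).val.comp
    (aeval fun i => (⟨partialS n k i, Algebra.subset_adjoin ⟨i, rfl⟩⟩ : diffAlg n k))

/-- `R` acts on `S` by `u • F = u(∂/∂y₁, …, ∂/∂yₙ) F`. -/
instance : Module (PolyR n k) (PolyS n k) :=
  Module.compHom (PolyS n k) (diffOp n k).toRingHom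

theorem smul_eq_diffOp (u : PolyR n k) (F : PolyS n k) : u • F = diffOp n k u F := rfl

theorem X_smul (i : Fin n) (F : PolyS n k) : (X i : PolyR n k) • F = partialS n k i F := by
  simp [smul_eq_diffOp, diffOp]

instance : IsScalarTower k (PolyR n k) (PolyS n k) where
  smul_assoc c u F := by simp [smul_eq_diffOp]

end Basic

section Grading

variable (n : ℕ) (k : Type u) [Field k]

/-- The graded piece `R_i` of `R`. -/
abbrev gradeR (i : ℕ) : Submodule k (PolyR n k) := homogeneousSubmodule (Fin n) k i

/-- The graded piece `S_i` of `S`. -/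
def gradeS (i : ℕ) : Submodule k (PolyS n k) :=
  (homogeneousSubmodule (Fin n) k i).comap (toPoly n k).toLinearMap

variable {n k}

theorem partialS_mem {i m : ℕ} {j : Fin n} {F : PolyS n k} (hF : F ∈ gradeS n k m) (h : m - 1 = i) :
    partialS n k j F ∈ gradeS n k i := by
  subst h
  exact IsHomogeneous.pderiv (i := j) (φ := toPoly n k F) hF

theorem monomial_smul_mem {m : ℕ} (s : Fin n →₀ ℕ) (c : k) {F : PolyS n k}
    (hF : F ∈ gradeS n k m) :
    (monomial s c : PolyR n k) • F ∈ gradeS n k (m - s.degree) := by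
  induction s using Finsupp.induction_linear generalizing c F m with
  | zero =>
    have : (monomial 0 c : PolyR n k) = c • 1 := by simp [← C_apply, smul_eq_C_mul]
    rw [this, smul_assoc, one_smul]
    simpa using Submodule.smul_mem _ c hF
  | add f g hf hg =>
    have : (monomial (f + g) c : PolyR n k) = monomial f c * monomial g 1 := by simp
    rw [this, mul_smul, map_add, add_comm, ← Nat.sub_sub]
    exact hf _ (hg _ hF)
  | single a b =>
    have : (monomial (Finsupp.single a b) c : PolyR n k) = c • X a ^ b := by
      rw [X_pow_eq_monomial, smul_monomial]; simp
    rw [this, smul_assoc]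
    refine Submodule.smul_mem _ c ?_
    rw [Finsupp.degree_single]
    clear this
    induction b with
    | zero => simpa using hF
    | succ b ih =>
      rw [pow_succ', mul_smul, X_smul]
      exact partialS_mem ih (by omega)

/-- Differentiation lowers degrees: `R_j • S_m ⊆ S_{m-j}`. -/
theorem smul_mem_gradeS {i j m : ℕ} (h : m - j = i) {u : PolyR n k} (hu : u ∈ gradeR n k j)
    {F : PolyS n k} (hF : F ∈ gradeS n k m) : u • F ∈ gradeS n k i := by
  subst h
  rw [u.as_sum, Finset.sum_smul]
  refine Submodule.sum_mem _ fun s hs => ?_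
  have : s.degree = j := by
    have := hu (mem_support_iff.mp hs)
    rwa [Finsupp.degree_eq_weight_one]
  rw [← this]
  exact monomial_smul_mem s _ hF

variable (n k)

/-- The internal product `R_{d-i} × S_d → S_i`. -/
def contract {i d : ℕ} (hi : i ≤ d) : gradeR n k (d - i) →ₗ[k] gradeS n k d →ₗ[k] gradeS n k i :=
  LinearMap.mk₂ k
    (fun u F => ⟨(u : PolyR n k) • (F : PolyS n k), smul_mem_gradeS (by omega) u.2 F.2⟩)
    (fun u v F => Subtype.ext (add_smul _ _ _))
    (fun c u F => Subtype.ext (smul_assoc _ _ _))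
    (fun u F G => Subtype.ext (smul_add _ _ _))
    (fun c u F => Subtype.ext (smul_comm _ _ _))

/-- The apolarity pairing `R_d × S_d → k`, `(u, F) ↦ u • F ∈ S_0 = k`. -/
def apolar (d : ℕ) : gradeR n k d →ₗ[k] gradeS n k d →ₗ[k] k :=
  LinearMap.mk₂ k
    (fun u F => coeff 0 (toPoly n k ((u : PolyR n k) • (F : PolyS n k))))
    (fun u v F => by simp [add_smul])
    (fun c u F => by simp)
    (fun u F G => by simp)
    (fun c u F => by simp [smul_comm _ c])

end Grading

/-! Graded modules, submodules, quotients, and homomorphisms of degree zero. -/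

section GradedModules

variable {k R M N : Type*} [CommRing k] [CommRing R] [Algebra k R]
  [AddCommGroup M] [Module k M] [Module R M] [IsScalarTower k R M]
  [AddCommGroup N] [Module k N] [Module R N] [IsScalarTower k R N]

/-- The graded piece `P_d` of a submodule `P` of a graded module, as a subspace of `M_d`. -/
def degPart (gr : ℕ → Submodule k M) (P : Submodule R M) (d : ℕ) : Submodule k (gr d) :=
  (P.restrictScalars k).comap (gr d).subtype

/-- The grading induced on a submodule. -/
def subGrade (gr : ℕ → Submodule k M) (P : Submodule R M) (i : ℕ) : Submodule k P :=
  (gr i).comap (P.subtype.restrictScalars k)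

/-- The grading induced on a quotient. -/
def quotGrade (gr : ℕ → Submodule k M) (P : Submodule R M) (i : ℕ) : Submodule k (M ⧸ P) :=
  (gr i).map (P.mkQ.restrictScalars k)

/-- The canonical injection `M_d / P_d → M / P`. -/
def degQuotIncl (gr : ℕ → Submodule k M) (P : Submodule R M) (d : ℕ) :
    (gr d ⧸ degPart gr P d) →ₗ[k] M ⧸ P :=
  (degPart gr P d).liftQ ((P.mkQ.restrictScalars k) ∘ₗ (gr d).subtype) (fun x hx => by
    simpa [degPart] using hx)

theorem degQuotIncl_injective (gr : ℕ → Submodule k M) (P : Submodule R M) (d : ℕ) :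
    Function.Injective (degQuotIncl gr P d) := by
  rw [← LinearMap.ker_eq_bot, degQuotIncl, Submodule.ker_liftQ_eq_bot']
  ext x
  simp [degPart]

/-- The space `Hom_R(M, N)_0` of `R`-linear maps `M → N` that preserve degrees. -/
def homZero (grM : ℕ → Submodule k M) (grN : ℕ → Submodule k N) : Submodule k (M →ₗ[R] N) where
  carrier := {ψ | ∀ i, ∀ m ∈ grM i, ψ m ∈ grN i}
  add_mem' ha hb i m hm := add_mem (ha i m hm) (hb i m hm)
  zero_mem' i _ _ := zero_mem (grN i)
  smul_mem' c _ ha i m hm := (grN i).smul_mem c (ha i m hm)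

/-- The inclusion of `P_d ⊆ M_d` into `P`. -/
def degIncl (gr : ℕ → Submodule k M) (P : Submodule R M) (d : ℕ) : degPart gr P d →ₗ[k] P :=
  ((gr d).subtype ∘ₗ (degPart gr P d).subtype).codRestrict (P.restrictScalars k) (fun x => x.2)

theorem range_degQuotIncl (gr : ℕ → Submodule k M) (P : Submodule R M) (d : ℕ) :
    LinearMap.range (degQuotIncl gr P d) = quotGrade gr P d := by
  rw [degQuotIncl, Submodule.range_liftQ, LinearMap.range_comp, Submodule.range_subtype, quotGrade]

/-- The identification of `M_d / P_d` with the graded piece `(M / P)_d`. -/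
def degQuotEquiv (gr : ℕ → Submodule k M) (P : Submodule R M) (d : ℕ) :
    (gr d ⧸ degPart gr P d) ≃ₗ[k] quotGrade gr P d :=
  (LinearEquiv.ofInjective _ (degQuotIncl_injective gr P d)).trans
    (LinearEquiv.ofEq _ _ (range_degQuotIncl gr P d))

/-- The map `Hom_R(P, M/P)_0 → Hom_k(P_d, M_d/P_d)` sending `ψ` to its degree `d` component. -/
def degComponent (gr : ℕ → Submodule k M) (P : Submodule R M) (d : ℕ) :
    homZero (R := R) (subGrade gr P) (quotGrade gr P) →ₗ[k]
      (degPart gr P d →ₗ[k] gr d ⧸ degPart gr P d) where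
  toFun ψ := (degQuotEquiv gr P d).symm.toLinearMap ∘ₗ
    ((ψ.1.restrictScalars k) ∘ₗ degIncl gr P d).codRestrict (quotGrade gr P d)
      (fun x => ψ.2 d (degIncl gr P d x) x.1.2)
  map_add' ψ ψ' := by
    ext x
    simp only [LinearMap.comp_apply, LinearMap.add_apply, LinearEquiv.coe_coe, ← map_add]
    rfl
  map_smul' c ψ := by
    ext x
    change (degQuotEquiv gr P d).symm _ = c • (degQuotEquiv gr P d).symm _
    rw [← map_smul]
    rfl

theorem degQuotIncl_degComponent (gr : ℕ → Submodule k M) (P : Submodule R M) (d : ℕ)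
    (ψ : homZero (R := R) (subGrade gr P) (quotGrade gr P)) (x : degPart gr P d) :
    degQuotIncl gr P d (degComponent gr P d ψ x) = ψ.1 (degIncl gr P d x) :=
  congrArg Subtype.val ((degQuotEquiv gr P d).apply_symm_apply
    ⟨ψ.1 (degIncl gr P d x), ψ.2 d (degIncl gr P d x) x.1.2⟩)

end GradedModules

section Level

attribute [local instance] MvPolynomial.gradedAlgebra

variable {n : ℕ} {k : Type u} [Field k]

/-- Macaulay's inverse system `I⁻¹ = {F ∈ S : u • F = 0 for all u ∈ I}`. -/
def inverseSystem (I : Ideal (PolyR n k)) : Submodule (PolyR n k) (PolyS n k) :=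
  Submodule.torsionBySet (PolyR n k) (PolyS n k) (I : Set (PolyR n k))

/-- The quotient `(I²)⁻¹ / I⁻¹`. -/
abbrev SqQuotient (I : Ideal (PolyR n k)) : Type u :=
  inverseSystem (I ^ 2) ⧸ (inverseSystem I).submoduleOf (inverseSystem (I ^ 2))

/-- The grading of `(I²)⁻¹ / I⁻¹`. -/
def sqQuotientGrade (I : Ideal (PolyR n k)) : ℕ → Submodule k (SqQuotient I) :=
  quotGrade (subGrade (gradeS n k) (inverseSystem (I ^ 2)))
    ((inverseSystem I).submoduleOf (inverseSystem (I ^ 2)))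

/-- The canonical map `(I²)⁻¹ / I⁻¹ → S / I⁻¹`. -/
def sqQuotientIncl (I : Ideal (PolyR n k)) :
    SqQuotient I →ₗ[PolyR n k] PolyS n k ⧸ inverseSystem I :=
  Submodule.mapQ _ _ (inverseSystem (I ^ 2)).subtype le_rfl

/-- The grading of `I / I²`. -/
def cotangentGrade (I : Ideal (PolyR n k)) (i : ℕ) : Submodule k I.Cotangent :=
  (subGrade (gradeR n k) I i).map (I.toCotangent.restrictScalars k)

/-- The Hilbert function `i ↦ dim_k (R/I)_i`. -/
def hilbertFn (I : Ideal (PolyR n k)) (i : ℕ) : ℕ :=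
  Module.finrank k (quotGrade (gradeR n k) I i)

/-- `R/I` is a graded artin level algebra of socle degree `d` and type `t`. -/
structure IsArtinLevel (I : Ideal (PolyR n k)) (t d : ℕ) : Prop where
  homogeneous : I.IsHomogeneous (homogeneousSubmodule (Fin n) k)
  artinian : IsArtinianRing (PolyR n k ⧸ I)
  top_ne_bot : quotGrade (gradeR n k) I d ≠ ⊥
  eq_bot : ∀ i, d < i → quotGrade (gradeR n k) I i = ⊥
  socle : ∀ a : PolyR n k ⧸ I,
    (∀ j : Fin n, a * Ideal.Quotient.mk I (X j) = 0) ↔ a ∈ quotGrade (gradeR n k) I d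
  type : hilbertFn I d = t

end Level

/-! Determinantal ideals. -/

section Minors

variable {B M P : Type*} [CommRing B] [AddCommMonoid M] [Module B M]
  [AddCommMonoid P] [Module B P]

/-- The ideal generated by the `r × r` minors of a linear map `f`, that is, by the determinants
`det (ξ_a (f w_b))` for vectors `w_1, …, w_r` in the source and functionals `ξ_1, …, ξ_r` on the
target. If source and target are free, these are the `r × r` minors of a matrix of `f`. -/
def minorIdeal (f : M →ₗ[B] P) (r : ℕ) : Ideal B :=
  Ideal.span (Set.range fun p : (Fin r → M) × (Fin r → Module.Dual B P) =>
    (Matrix.of fun a b => p.2 a (f (p.1 b))).det)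

theorem minorIdeal_le {ι κ : Type*} (f : M →ₗ[B] P) (r : ℕ) (J : Ideal B)
    (g : ι → M) (hg : Submodule.span B (Set.range g) = ⊤)
    (e : κ → Module.Dual B P) (he : Submodule.span B (Set.range e) = ⊤)
    (h : ∀ (w : Fin r → ι) (ξ : Fin r → κ),
      (Matrix.of fun a b => e (ξ a) (f (g (w b)))).det ∈ J) :
    minorIdeal f r ≤ J := by
  have h1 : ∀ (w : Fin r → M) (ξ : Fin r → κ),
      (Matrix.of fun a b => e (ξ a) (f (w b))).det ∈ J := by
    intro w ξ
    let φ : MultilinearMap B (fun _ : Fin r => M) (B ⧸ J) :=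
      (Submodule.mkQ J).compMultilinearMap
        ((Matrix.detRowAlternating (n := Fin r) (R := B)).toMultilinearMap.compLinearMap
          (fun _ => LinearMap.pi fun a => e (ξ a) ∘ₗ f))
    have hφ : ∀ w, φ w = Submodule.Quotient.mk
        (Matrix.of fun a b => e (ξ a) (f (w b))).det := by
      intro w
      rw [← Matrix.det_transpose]
      rfl
    have : φ = 0 := MultilinearMap.ext_of_span_eq_top (g := fun _ => g) (fun _ => hg) (by
      intro j
      rw [hφ]
      exact (Submodule.Quotient.mk_eq_zero J).mpr (h j ξ))
    have h2 := hφ w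
    rw [this] at h2
    exact (Submodule.Quotient.mk_eq_zero J).mp h2.symm
  refine Ideal.span_le.mpr ?_
  rintro _ ⟨⟨w, ξ⟩, rfl⟩
  let φ : MultilinearMap B (fun _ : Fin r => Module.Dual B P) (B ⧸ J) :=
    (Submodule.mkQ J).compMultilinearMap
      ((Matrix.detRowAlternating (n := Fin r) (R := B)).toMultilinearMap.compLinearMap
        (fun _ => LinearMap.pi fun b => Module.Dual.eval B P (f (w b))))
  have hφ : ∀ ξ, φ ξ = Submodule.Quotient.mk
      (Matrix.of fun a b => ξ a (f (w b))).det := fun ξ => rfl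
  have : φ = 0 := MultilinearMap.ext_of_span_eq_top (g := fun _ => e) (fun _ => he) (by
    intro j
    rw [hφ]
    exact (Submodule.Quotient.mk_eq_zero J).mpr (h1 w j))
  have h2 := hφ ξ
  rw [this] at h2
  exact (Submodule.Quotient.mk_eq_zero J).mp h2.symm

variable {k : Type*} [CommRing k] [Algebra k B] {V W U : Type*}
  [AddCommGroup V] [Module k V] [AddCommGroup W] [Module k W] [AddCommGroup U] [Module k U]

/-- For a bilinear map `c : U × V → W` over `k` and a submodule `N` of `B ⊗ V`, the `B`-linear map
`N ⊗ U → B ⊗ W` induced by `c`. -/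
def productMap (c : U →ₗ[k] V →ₗ[k] W) (N : Submodule B (B ⊗[k] V)) :
    N ⊗[k] U →ₗ[B] B ⊗[k] W :=
  AlgebraTensorModule.lift
    ((((LinearMap.baseChangeHom k B V W) ∘ₗ c).flip) ∘ₗ N.subtype)

@[simp] theorem productMap_tmul (c : U →ₗ[k] V →ₗ[k] W) (N : Submodule B (B ⊗[k] V))
    (F : N) (u : U) : productMap c N (F ⊗ₜ u) = (c u).baseChange B (F : B ⊗[k] V) := rfl

end Minors

section BaseChange

theorem exists_of_mkQ_baseChange {A X : Type*} [CommRing A] [AddCommGroup X] [Module A X]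
    {B : Type*} [CommRing B] [Algebra A B] (N : Submodule A X) (z : B ⊗[A] X)
    (hz : N.mkQ.baseChange B z = 0) : ∃ y : B ⊗[A] N, LinearMap.lTensor B N.subtype y = z :=
  (lTensor_exact B (LinearMap.exact_subtype_mkQ N) (Submodule.mkQ_surjective _) z).mp hz

variable {k : Type*} [CommRing k] {A B : Type u} [CommRing A] [Algebra k A] [CommRing B]
  [Algebra k B] (f : A →ₐ[k] B) (V : Type*) [AddCommGroup V] [Module k V]

/-- The map `A ⊗ V → B ⊗ V` induced by an algebra map `A → B`. -/
def scalarMap : A ⊗[k] V →ₗ[k] B ⊗[k] V := LinearMap.rTensor V f.toLinearMap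

@[simp] theorem scalarMap_tmul (a : A) (v : V) : scalarMap f V (a ⊗ₜ v) = f a ⊗ₜ v := rfl

theorem scalarMap_smul (a : A) (x : A ⊗[k] V) :
    scalarMap f V (a • x) = f a • scalarMap f V x := by
  induction x with
  | zero => simp
  | tmul b v => simp [smul_tmul']
  | add x y hx hy => simp [hx, hy]

variable {V}

theorem baseChange_scalarMap {W : Type*} [AddCommGroup W] [Module k W] (g : V →ₗ[k] W)
    (x : A ⊗[k] V) :
    g.baseChange B (scalarMap f V x) = scalarMap f W (g.baseChange A x) := by
  induction x with
  | zero => simp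
  | tmul b v => simp
  | add x y hx hy => simp [hx, hy]

/-- The base change of a point of the Grassmannian is generated by its image. -/
theorem map_eq_span {c : ℕ} (N : Module.Grassmannian A (A ⊗[k] V) c) :
    (Module.Grassmannian.map f N).toSubmodule =
      Submodule.span B (scalarMap f V '' (N.toSubmodule : Set (A ⊗[k] V))) := by
  rw [Module.Grassmannian.map_toSubmodule]
  let _ : Algebra A B := f.toAlgebra
  let _ : IsScalarTower k A B := IsScalarTower.of_algebraMap_eq' f.comp_algebraMap.symm
  let e := AlgebraTensorModule.cancelBaseChange k A B B V
  have he : ∀ x : A ⊗[k] V, e (1 ⊗ₜ x) = scalarMap f V x := by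
    intro x
    induction x with
    | zero => simp
    | tmul b v =>
      simp only [e, AlgebraTensorModule.cancelBaseChange_tmul, scalarMap_tmul,
        Algebra.smul_def, mul_one]
      rfl
    | add x y hx hy => rw [tmul_add, map_add, hx, hy, map_add]
  apply le_antisymm
  · intro x hx
    obtain ⟨y, hy⟩ := exists_of_mkQ_baseChange (B := B) N.toSubmodule (e.symm x) hx
    have hx' : x = e (LinearMap.lTensor B N.toSubmodule.subtype y) := by rw [hy]; simp
    rw [hx']
    clear hy hx' hx
    induction y with
    | zero => simp
    | tmul b v =>
      have : e (b ⊗ₜ[A] (v : A ⊗[k] V)) = b • scalarMap f V v := by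
        rw [← he, ← map_smul, smul_tmul', smul_eq_mul, mul_one]
      rw [LinearMap.lTensor_tmul, Submodule.subtype_apply, this]
      exact Submodule.smul_mem _ _ (Submodule.subset_span ⟨v, v.2, rfl⟩)
    | add y z hy hz =>
      rw [map_add, map_add]
      exact add_mem hy hz
  · rw [Submodule.span_le]
    rintro _ ⟨x, hx, rfl⟩
    change (N.toSubmodule.mkQ.baseChange B) (e.symm (scalarMap f V x)) = 0
    rw [← he, LinearEquiv.symm_apply_apply, LinearMap.baseChange_tmul,
      (Submodule.Quotient.mk_eq_zero _).mpr hx |> fun h => (h : N.toSubmodule.mkQ x = 0), tmul_zero]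

theorem scalarMap_mem {c : ℕ} (N : Module.Grassmannian A (A ⊗[k] V) c) {x : A ⊗[k] V}
    (hx : x ∈ N.toSubmodule) : scalarMap f V x ∈ (Module.Grassmannian.map f N).toSubmodule := by
  rw [map_eq_span]
  exact Submodule.subset_span ⟨x, hx, rfl⟩

variable {W U : Type*} [AddCommGroup W] [Module k W] [AddCommGroup U] [Module k U]

/-- The map `N ⊗ U → N_B ⊗ U` for the base change `N_B` of `N`. -/
def scalarMapSub {c : ℕ} (N : Module.Grassmannian A (A ⊗[k] V) c) :
    N.toSubmodule ⊗[k] U →ₗ[k] (Module.Grassmannian.map f N).toSubmodule ⊗[k] U :=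
  LinearMap.rTensor U
    (((scalarMap f V).comp (N.toSubmodule.subtype.restrictScalars k)).codRestrict
      ((Module.Grassmannian.map f N).toSubmodule.restrictScalars k)
      (fun x => scalarMap_mem f N x.2))

theorem productMap_scalarMapSub (cc : U →ₗ[k] V →ₗ[k] W) {c : ℕ}
    (N : Module.Grassmannian A (A ⊗[k] V) c) (x : N.toSubmodule ⊗[k] U) :
    productMap cc (Module.Grassmannian.map f N).toSubmodule (scalarMapSub f N x) =
      scalarMap f W (productMap cc N.toSubmodule x) := by
  induction x with
  | zero => simp
  | tmul b v => exact baseChange_scalarMap f (cc v) _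
  | add x y hx hy => rw [map_add, map_add, hx, hy, map_add, map_add]

/-- The functional on `B ⊗ W` induced by a functional on `A ⊗ W`. -/
def dualMap (ξ : Module.Dual A (A ⊗[k] W)) : Module.Dual B (B ⊗[k] W) :=
  LinearMap.liftBaseChange B
    (f.toLinearMap ∘ₗ (ξ.restrictScalars k) ∘ₗ (TensorProduct.mk k A W 1))

theorem dualMap_scalarMap (ξ : Module.Dual A (A ⊗[k] W)) (x : A ⊗[k] W) :
    dualMap f ξ (scalarMap f W x) = f (ξ x) := by
  induction x with
  | zero => simp
  | tmul a w =>
    have : a ⊗ₜ[k] w = a • (1 ⊗ₜ[k] w) := by simp [smul_tmul']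
    rw [scalarMap_tmul, this, map_smul]
    simp [dualMap]
  | add x y hx hy => rw [map_add, map_add, hx, hy, map_add, map_add]

theorem minorIdeal_map_le (cc : U →ₗ[k] V →ₗ[k] W) {c : ℕ}
    (N : Module.Grassmannian A (A ⊗[k] V) c) (r : ℕ) :
    (minorIdeal (productMap cc N.toSubmodule) r).map f ≤
      minorIdeal (productMap cc (Module.Grassmannian.map f N).toSubmodule) r := by
  rw [Ideal.map_le_iff_le_comap, minorIdeal, Ideal.span_le]
  rintro _ ⟨⟨w, ξ⟩, rfl⟩
  refine Ideal.subset_span ⟨⟨fun b => scalarMapSub f N (w b), fun a => dualMap f (ξ a)⟩, ?_⟩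
  have := (f : A →+* B).map_det (Matrix.of fun a b => ξ a (productMap cc N.toSubmodule (w b)))
  refine Eq.trans ?_ this.symm
  refine congrArg Matrix.det ?_
  ext a b
  simp [productMap_scalarMapSub, dualMap_scalarMap]

theorem minorIdeal_le_map [Module.Free k W] [Module.Finite k W]
    (cc : U →ₗ[k] V →ₗ[k] W) {c : ℕ}
    (N : Module.Grassmannian A (A ⊗[k] V) c) (r : ℕ) :
    minorIdeal (productMap cc (Module.Grassmannian.map f N).toSubmodule) r ≤
      (minorIdeal (productMap cc N.toSubmodule) r).map f := by
  let bA := (Module.Free.chooseBasis k W).baseChange A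
  let bB := (Module.Free.chooseBasis k W).baseChange B
  have hcoord : ∀ i, bB.coord i = dualMap f (bA.coord i) := by
    intro i
    refine LinearMap.ext fun x => ?_
    induction x with
    | zero => simp
    | tmul b w => simp [bA, bB, dualMap, Algebra.smul_def, mul_comm]
    | add x y hx hy => rw [map_add, map_add, hx, hy]
  refine minorIdeal_le _ r _ (fun x => scalarMapSub f N x) ?_ bB.coord ?_ ?_
  · rw [eq_top_iff]
    rintro x -
    induction x with
    | zero => simp
    | add x y hx hy => exact add_mem hx hy
    | tmul y u =>
      obtain ⟨y, hy⟩ := y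
      have hy' := hy
      rw [map_eq_span] at hy'
      induction hy' using Submodule.span_induction with
      | mem z hz =>
        obtain ⟨x, hx, rfl⟩ := hz
        exact Submodule.subset_span ⟨(⟨x, hx⟩ : N.toSubmodule) ⊗ₜ u, rfl⟩
      | zero =>
        have : (⟨0, hy⟩ : (Module.Grassmannian.map f N).toSubmodule) = 0 := rfl
        rw [this, zero_tmul]
        exact zero_mem _
      | add x z hx hz ihx ihz =>
        rw [← map_eq_span] at hx hz
        have := add_mem (ihx hx) (ihz hz)
        rwa [← add_tmul] at this
      | smul b x hx ih =>
        rw [← map_eq_span] at hx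
        exact Submodule.smul_mem _ b (ih hx)
  · have := bB.dualBasis.span_eq
    rwa [Module.Basis.coe_dualBasis] at this
  · intro w ξ
    have := (f : A →+* B).map_det
      (Matrix.of fun a b => bA.coord (ξ a) (productMap cc N.toSubmodule (w b)))
    have h2 : (Matrix.of fun a b => bA.coord (ξ a) (productMap cc N.toSubmodule (w b))).det ∈
        minorIdeal (productMap cc N.toSubmodule) r :=
      Ideal.subset_span ⟨⟨w, fun a => bA.coord (ξ a)⟩, rfl⟩
    have h3 := Ideal.mem_map_of_mem f h2
    convert h3 using 1
    refine Eq.trans ?_ this.symm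
    congr 1
    ext a b
    simp only [productMap_scalarMapSub, hcoord, dualMap_scalarMap, Matrix.of_apply]
    rfl

/-- The `B`-bilinear extension of a pairing `V × W → k`. -/
def pairing (B : Type*) [CommRing B] [Algebra k B] (p : V →ₗ[k] W →ₗ[k] k) :
    B ⊗[k] V →ₗ[B] Module.Dual B (B ⊗[k] W) :=
  LinearMap.liftBaseChange B (Module.Dual.baseChange B ∘ₗ p)

@[simp] theorem pairing_tmul (B : Type*) [CommRing B] [Algebra k B] (p : V →ₗ[k] W →ₗ[k] k)
    (a b : B) (v : V) (w : W) :
    pairing B p (a ⊗ₜ v) (b ⊗ₜ w) = a * b * algebraMap k B (p v w) := by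
  simp [pairing, Algebra.smul_def, mul_assoc, mul_comm]

/-- The orthogonal `N^⊥` in `B ⊗ V` of a submodule `N` of `B ⊗ W`. -/
def perp {B : Type*} [CommRing B] [Algebra k B] (p : V →ₗ[k] W →ₗ[k] k)
    (N : Submodule B (B ⊗[k] W)) : Submodule B (B ⊗[k] V) where
  carrier := {u | ∀ F ∈ N, pairing B p u F = 0}
  add_mem' ha hb F hF := by simp [ha F hF, hb F hF]
  zero_mem' F _ := by simp
  smul_mem' c u hu F hF := by simp [hu F hF]

theorem pairing_scalarMap (p : V →ₗ[k] W →ₗ[k] k) (u : A ⊗[k] V) (F : A ⊗[k] W) :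
    pairing B p (scalarMap f V u) (scalarMap f W F) = f (pairing A p u F) := by
  induction u with
  | zero => simp
  | add x y hx hy => simp [hx, hy]
  | tmul a v =>
    induction F with
    | zero => simp
    | add x y hx hy => rw [map_add, map_add, hx, hy, map_add, map_add]
    | tmul b w => simp

theorem pairing_bijective [Module.Free k W] [Module.Finite k W] (p : V →ₗ[k] W →ₗ[k] k)
    (hp : Function.Bijective p) (B : Type*) [CommRing B] [Algebra k B] :
    Function.Bijective (pairing B p) := by
  classical
  let b := Module.Free.chooseBasis k W
  let v := b.dualBasis.map (LinearEquiv.ofBijective p hp).symm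
  have hv : ∀ i j, p (v i) (b j) = if j = i then 1 else 0 := by
    intro i j
    have : p (v i) = b.dualBasis i := by
      change LinearEquiv.ofBijective p hp (v i) = _
      simp [v]
    rw [this, Module.Basis.dualBasis_apply_self]
  have key : ∀ (c : Module.Free.ChooseBasisIndex k W → B) (j),
      pairing B p (∑ i, c i • (v.baseChange B) i) (1 ⊗ₜ b j) = c j := by
    intro c j
    simp [smul_tmul', LinearMap.sum_apply, hv, apply_ite]
  constructor
  · rw [injective_iff_map_eq_zero]
    intro u hu
    rw [← (v.baseChange B).sum_repr u] at hu ⊢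
    refine Finset.sum_eq_zero fun j _ => ?_
    have := key (fun i => (v.baseChange B).repr u i) j
    rw [hu] at this
    rw [← this]
    simp
  · intro φ
    refine ⟨∑ i, φ (1 ⊗ₜ b i) • (v.baseChange B) i, ?_⟩
    refine (b.baseChange B).ext fun j => ?_
    rw [Module.Basis.baseChange_apply, key]

theorem perp_map [Module.Free k W] [Module.Finite k W] (p : V →ₗ[k] W →ₗ[k] k)
    (hp : Function.Bijective p) {c : ℕ} (N : Module.Grassmannian A (A ⊗[k] W) c) :
    perp p (Module.Grassmannian.map f N).toSubmodule =
      Submodule.span B (scalarMap f V '' (perp p N.toSubmodule : Set (A ⊗[k] V))) := by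
  apply le_antisymm
  · intro u hu
    have hproj := N.projective_quotient
    obtain ⟨s, hs⟩ := Module.projective_lifting_property N.toSubmodule.mkQ LinearMap.id
      (Submodule.mkQ_surjective _)
    let q : A ⊗[k] W →ₗ[A] A ⊗[k] W := s ∘ₗ N.toSubmodule.mkQ
    have hqN : ∀ x ∈ N.toSubmodule, q x = 0 := by
      intro x hx
      have : N.toSubmodule.mkQ x = 0 := (Submodule.Quotient.mk_eq_zero _).mpr hx
      change s (N.toSubmodule.mkQ x) = 0
      rw [this, map_zero]
    have hq : ∀ x, x - q x ∈ N.toSubmodule := by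
      intro x
      rw [← Submodule.Quotient.mk_eq_zero]
      change N.toSubmodule.mkQ (x - s (N.toSubmodule.mkQ x)) = 0
      rw [map_sub, sub_eq_zero]
      exact (LinearMap.congr_fun hs (N.toSubmodule.mkQ x)).symm
    -- the transpose of `q`
    have htr : ∀ y : A ⊗[k] V, ∃ z ∈ perp p N.toSubmodule,
        ∀ x, pairing A p z x = pairing A p y (q x) := by
      intro y
      obtain ⟨z, hz⟩ := (pairing_bijective p hp A).2 ((pairing A p y) ∘ₗ q)
      refine ⟨z, fun x hx => ?_, fun x => by rw [hz]; rfl⟩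
      rw [hz, LinearMap.comp_apply, hqN x hx, map_zero]
    have hsp : ∀ u : B ⊗[k] V, ∃ z ∈ Submodule.span B (scalarMap f V ''
        (perp p N.toSubmodule : Set (A ⊗[k] V))),
        ∀ x : A ⊗[k] W, pairing B p z (scalarMap f W x) =
          pairing B p u (scalarMap f W (q x)) := by
      intro u
      induction u with
      | zero => exact ⟨0, zero_mem _, fun x => by simp⟩
      | add x y hx hy =>
        obtain ⟨z, hz, h⟩ := hx
        obtain ⟨z', hz', h'⟩ := hy
        exact ⟨z + z', add_mem hz hz', fun x => by simp [h, h']⟩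
      | tmul b v =>
        obtain ⟨z, hz, h⟩ := htr (1 ⊗ₜ v)
        refine ⟨b • scalarMap f V z, Submodule.smul_mem _ _ (Submodule.subset_span ⟨z, hz, rfl⟩),
          fun x => ?_⟩
        have : (b ⊗ₜ[k] v : B ⊗[k] V) = b • scalarMap f V (1 ⊗ₜ v) := by simp [smul_tmul']
        rw [this, map_smul, map_smul, LinearMap.smul_apply, LinearMap.smul_apply,
          pairing_scalarMap, pairing_scalarMap, h]
    obtain ⟨z, hz, h⟩ := hsp u
    suffices u = z by rwa [this]
    apply (pairing_bijective p hp B).1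
    have h1 : ∀ x : A ⊗[k] W, pairing B p u (scalarMap f W x) =
        pairing B p z (scalarMap f W x) := by
      intro x
      rw [h, ← sub_eq_zero, ← map_sub, ← map_sub]
      exact hu _ (scalarMap_mem f N (hq x))
    refine LinearMap.ext fun x => ?_
    induction x with
    | zero => simp
    | add x y hx hy => rw [map_add, map_add, hx, hy]
    | tmul b w =>
      have : (b ⊗ₜ[k] w : B ⊗[k] W) = b • scalarMap f W (1 ⊗ₜ w) := by simp [smul_tmul']
      rw [this, map_smul, map_smul, h1]
  · rw [Submodule.span_le]
    rintro _ ⟨u, hu, rfl⟩ F hF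
    rw [map_eq_span] at hF
    induction hF using Submodule.span_induction with
    | mem x hx =>
      obtain ⟨x, hx, rfl⟩ := hx
      rw [pairing_scalarMap, hu x hx, map_zero]
    | zero => simp
    | add x y _ _ hx hy => rw [map_add, hx, hy, add_zero]
    | smul b x _ hx => rw [map_smul, hx, smul_zero]

end BaseChange

section Locus

variable (n : ℕ) (k : Type u) [Field k]

instance instFiniteGradeR (i : ℕ) : Module.Finite k (gradeR n k i) := by
  have hle : gradeR n k i ≤ restrictTotalDegree (Fin n) k i := by
    intro p hp
    exact (mem_restrictTotalDegree _ _ _).mpr (IsHomogeneous.totalDegree_le hp)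
  exact Module.Finite.of_injective _ (Submodule.inclusion_injective hle)

instance instFiniteGradeS (i : ℕ) : Module.Finite k (gradeS n k i) :=
  instFiniteGradeR n k i

variable {n k} in
theorem exists_coeff_monomial_smul [CharZero k] (s m : Fin n →₀ ℕ) :
    ∃ c : k, c ≠ 0 ∧ ∀ F : PolyS n k,
      coeff m (toPoly n k ((monomial s 1 : PolyR n k) • F)) = c * coeff (m + s) (toPoly n k F) := by
  induction s using Finsupp.induction_linear generalizing m with
  | zero =>
    refine ⟨1, one_ne_zero, fun F => ?_⟩
    have : (monomial 0 1 : PolyR n k) = 1 := by simp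
    rw [this, one_smul, one_mul, add_zero]
  | add f g hf hg =>
    obtain ⟨a, ha, hf⟩ := hf m
    obtain ⟨b, hb, hg⟩ := hg (m + f)
    refine ⟨a * b, mul_ne_zero ha hb, fun F => ?_⟩
    have : (monomial (f + g) 1 : PolyR n k) = monomial f 1 * monomial g 1 := by simp
    rw [this, mul_smul, hf, hg, add_assoc, mul_assoc]
  | single i b =>
    have : (monomial (Finsupp.single i b) 1 : PolyR n k) = X i ^ b := by
      rw [X_pow_eq_monomial]
    rw [this]
    clear this
    induction b generalizing m with
    | zero => exact ⟨1, one_ne_zero, fun F => by simp⟩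
    | succ b ih =>
      obtain ⟨a, ha, h⟩ := ih (m + Finsupp.single i 1)
      refine ⟨a * (m i + 1), mul_ne_zero ha (by exact_mod_cast (m i).succ_ne_zero), fun F => ?_⟩
      rw [pow_succ', mul_smul, X_smul]
      have h1 : toPoly n k (partialS n k i ((X i ^ b : PolyR n k) • F)) =
        pderiv i (toPoly n k ((X i ^ b : PolyR n k) • F)) := rfl
      rw [h1, coeff_pderiv, h, Finsupp.single_add, add_assoc, add_comm (Finsupp.single i 1)]
      ring

/-- The apolarity pairing `R_d × S_d → k` is perfect in characteristic zero. -/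
theorem apolar_bijective [CharZero k] (d : ℕ) : Function.Bijective (apolar n k d) := by
  have hinj : Function.Injective (apolar n k d) := by
    rw [injective_iff_map_eq_zero]
    intro u hu
    refine Subtype.ext (MvPolynomial.ext _ _ fun s => ?_)
    rw [ZeroMemClass.coe_zero, coeff_zero]
    by_contra hs
    have hF : (toPoly n k).symm (monomial s 1) ∈ gradeS n k d := by
      have := u.2 hs
      exact isHomogeneous_monomial _ (by rwa [Finsupp.degree_eq_weight_one])
    have h0 := LinearMap.congr_fun hu ⟨_, hF⟩
    change coeff 0 (toPoly n k ((u : PolyR n k) • (toPoly n k).symm (monomial s 1))) = 0 at h0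
    rw [(u : PolyR n k).as_sum, Finset.sum_smul, map_sum, coeff_sum,
      Finset.sum_eq_single s] at h0
    · obtain ⟨c, hc, h⟩ := exists_coeff_monomial_smul (k := k) s 0
      have h2 : (monomial s (coeff s (u : PolyR n k)) : PolyR n k) =
          coeff s (u : PolyR n k) • monomial s 1 := by simp [smul_monomial]
      rw [h2, smul_assoc, map_smul, coeff_smul, h] at h0
      simp [hc, hs] at h0
    · intro a _ ha
      obtain ⟨c, hc, h⟩ := exists_coeff_monomial_smul (k := k) a 0
      have h2 : (monomial a (coeff a (u : PolyR n k)) : PolyR n k) =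
          coeff a (u : PolyR n k) • monomial a 1 := by simp [smul_monomial]
      rw [h2, smul_assoc, map_smul, coeff_smul, h]
      simp [coeff_monomial, Ne.symm ha]
    · intro h
      exact absurd (mem_support_iff.mpr hs) h
  refine ⟨hinj, ?_⟩
  refine (LinearMap.injective_iff_surjective_of_finrank_eq_finrank ?_).mp hinj
  rw [Subspace.dual_finrank_eq]
  rfl

/-- The Grassmannian `G(t, S_d)` of `t`-dimensional subspaces of `S_d`, as a functor of points;
its points over a `k`-algebra `B` are the submodules of `B ⊗ S_d` with locally free quotient of rank
`dim S_d - t`. -/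
abbrev grassS (t d : ℕ) : CommAlgCat.{u} k ⥤ Type u :=
  Module.Grassmannian.functor (R := k) (M := gradeS n k d)
    (Module.finrank k (gradeS n k d) - t)

/-- The Grassmannian `G(dim R_d - t, R_d)` of subspaces of `R_d` of codimension `t`, as a functor of
points; its points over a `k`-algebra `B` are the submodules of `B ⊗ R_d` with locally free quotient
of rank `t`. -/
abbrev grassR (t d : ℕ) : CommAlgCat.{u} k ⥤ Type u :=
  Module.Grassmannian.functor (R := k) (M := gradeR n k d) t

/-- The locally closed subscheme of `G(t, S_d)` where the map `φ_i : 𝓑 ⊗ R_{d-i} → S_i ⊗ 𝓞` has rank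
`r`, as a functor of points: the `(r + 1) × (r + 1)` minors of `φ_i` vanish, and the `r × r` minors
generate the unit ideal. -/
def rankLocus (t : ℕ) {i d : ℕ} (hi : i ≤ d) (r : ℕ) : Subfunctor (grassS n k t d) where
  obj B := {N | minorIdeal (productMap (contract n k hi) N.toSubmodule) (r + 1) = ⊥ ∧
    minorIdeal (productMap (contract n k hi) N.toSubmodule) r = ⊤}
  map {A B} f N hN := by
    refine ⟨eq_bot_iff.mpr ?_, eq_top_iff.mpr ?_⟩
    · refine (minorIdeal_le_map f.hom _ N _).trans ?_
      rw [hN.1, Ideal.map_bot]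
    · refine le_trans ?_ (minorIdeal_map_le f.hom _ N _)
      rw [hN.2, Ideal.map_top]

/-- The scheme `𝓛°(h)` as a locally closed subscheme of `G(t, S_d)`. -/
def levelLocus (t d : ℕ) (h : ℕ → ℕ) : Subfunctor (grassS n k t d) :=
  ⨅ i : Set.Ico 1 d, rankLocus n k t i.2.2.le (h i)

/-- The scheme `𝓛°(h)` as a locally closed subscheme of `G(dim R_d - t, R_d)`, via the isomorphism
`N ↦ N^⊥` from `G(t, S_d)` to `G(dim R_d - t, R_d)`. -/
def levelLocusDual [CharZero k] (t d : ℕ) (h : ℕ → ℕ) : Subfunctor (grassR n k t d) where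
  obj B := {M | ∃ N ∈ (levelLocus n k t d h).obj B,
    M.toSubmodule = perp (apolar n k d) N.toSubmodule}
  map {A B} f M hM := by
    obtain ⟨N, hN, hMN⟩ := hM
    refine ⟨(grassS n k t d).map f N, (levelLocus n k t d h).map f hN, ?_⟩
    have h1 := perp_map f.hom (apolar n k d) (apolar_bijective n k d) N
    have h2 := map_eq_span f.hom M
    rw [hMN, ← h1] at h2
    exact h2

end Locus

/-! Tangent spaces of functors of points. -/

section Tangent

variable {k : Type u} [Field k]

/-- The point `ε = 0` of the spectrum of the algebra `k ⊕ W` with `W² = 0`. -/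
def origin (k : Type u) [Field k] (W : Type u) [AddCommGroup W] [Module k W] [Module kᵐᵒᵖ W]
    [IsCentralScalar k W] :
    CommAlgCat.of k (TrivSqZeroExt k W) ⟶ CommAlgCat.of k k :=
  CommAlgCat.ofHom (TrivSqZeroExt.fstHom k k W)

/-- The map `k ⊕ W → k ⊕ W'` induced by a linear map `W → W'`. -/
def sqZeroMap {W W' : Type u} [AddCommGroup W] [Module k W] [Module kᵐᵒᵖ W]
    [IsCentralScalar k W] [AddCommGroup W'] [Module k W'] [Module kᵐᵒᵖ W'] [IsCentralScalar k W']
    (g : W →ₗ[k] W') :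
    CommAlgCat.of k (TrivSqZeroExt k W) ⟶ CommAlgCat.of k (TrivSqZeroExt k W') :=
  CommAlgCat.ofHom (TrivSqZeroExt.map g)

/-- The Zariski tangent space at a `k`-point `x` of a functor of points `X`: the set of points of
`X` over the dual numbers `k[ε]` that specialize to `x` at `ε = 0`. -/
def TangentSpace (X : CommAlgCat.{u} k ⥤ Type u) (x : X.obj (CommAlgCat.of k k)) : Type u :=
  {v : X.obj (CommAlgCat.of k (DualNumber k)) // X.map (origin k k) v = x}

namespace TangentSpace

variable {X Y : CommAlgCat.{u} k ⥤ Type u} {x : X.obj (CommAlgCat.of k k)}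

/-- The multiple `c • v` is the image of `v` under the substitution `ε ↦ c ε`. -/
instance : SMul k (TangentSpace X x) where
  smul c v := ⟨X.map (sqZeroMap (c • LinearMap.id)) v.1, by
    have h : sqZeroMap (c • (LinearMap.id : k →ₗ[k] k)) ≫ origin k k = origin k k := by
      ext
      simp [sqZeroMap, origin]
    rw [← ConcreteCategory.comp_apply, ← X.map_comp, h, v.2]⟩

/-- `w` is the sum of `u` and `v`: there is a point of `X` over `k[ε₁, ε₂]/(ε₁, ε₂)²` that restricts
to `u` under `(ε₁, ε₂) ↦ (ε, 0)`, to `v` under `(ε₁, ε₂) ↦ (0, ε)`, and to `w` under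
`(ε₁, ε₂) ↦ (ε, ε)`. -/
def IsSum (u v w : TangentSpace X x) : Prop :=
  ∃ z : X.obj (CommAlgCat.of k (TrivSqZeroExt k (k × k))),
    X.map (sqZeroMap (LinearMap.fst k k k)) z = u.1 ∧
    X.map (sqZeroMap (LinearMap.snd k k k)) z = v.1 ∧
    X.map (sqZeroMap (LinearMap.fst k k k + LinearMap.snd k k k)) z = w.1

/-- The differential `T_{X,x} → T_{Y,η(x)}` of a morphism `η : X → Y`. -/
def differential (η : X ⟶ Y) (x : X.obj (CommAlgCat.of k k)) (v : TangentSpace X x) :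
    TangentSpace Y (η.app _ x) :=
  ⟨η.app _ v.1, by
    rw [← NatTrans.naturality_apply, v.2]⟩

end TangentSpace

/-- An isomorphism of `k`-vector spaces from the tangent space `T_{X,x}` to `W`. -/
structure TangentIso (X : CommAlgCat.{u} k ⥤ Type u) (x : X.obj (CommAlgCat.of k k))
    (W : Type u) [AddCommGroup W] [Module k W] extends TangentSpace X x ≃ W where
  map_smul : ∀ (c : k) (v : TangentSpace X x), toFun (c • v) = c • toFun v
  isSum_iff : ∀ u v w : TangentSpace X x,
    TangentSpace.IsSum u v w ↔ toFun w = toFun u + toFun v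

/-- `e` is the canonical isomorphism `T_{G,Λ} = Hom_k(Λ, U/Λ)` for the Grassmannian `G` of a
vector space `U` at the point `Λ`: a first order deformation `Λ_ε ⊆ k[ε] ⊗ U` of `Λ` corresponds to
the map `τ : Λ → U/Λ` such that `F + ε G ∈ Λ_ε` if and only if `τ(F) = G mod Λ`, for `F ∈ Λ` and
`G ∈ U`. -/
def IsCanonicalGrassIso {U : Type u} [AddCommGroup U] [Module k U] (Λ : Submodule k U) {c : ℕ}
    {x : (Module.Grassmannian.functor (R := k) (M := U) c).obj (CommAlgCat.of k k)}
    (e : TangentIso (Module.Grassmannian.functor (R := k) (M := U) c) x (Λ →ₗ[k] U ⧸ Λ)) : Prop :=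
  ∀ (v : TangentSpace (Module.Grassmannian.functor (R := k) (M := U) c) x) (F : Λ) (G : U),
    (1 : DualNumber k) ⊗ₜ[k] (F : U) + (DualNumber.eps : DualNumber k) ⊗ₜ[k] G ∈
        (show Module.Grassmannian (DualNumber k) (DualNumber k ⊗[k] U) c from v.1).toSubmodule ↔
      e.toEquiv v F = Submodule.Quotient.mk G

/-- The assertion that the closed point `P_d` lies on the locally closed subscheme `L` of the
Grassmannian of `M_d`, and that the canonical isomorphism `T_{G,P_d} = Hom_k(P_d, M_d/P_d)`
identifies `T_{L,P_d} ⊆ T_{G,P_d}` with `Hom_R(P, M/P)_0 ⊆ Hom_k(P_d, M_d/P_d)`. -/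
def TangentSpaceIsHomZero {R M : Type u} [CommRing R] [Algebra k R] [AddCommGroup M] [Module k M]
    [Module R M] [IsScalarTower k R M] (gr : ℕ → Submodule k M) (P : Submodule R M) (d : ℕ) {c : ℕ}
    (L : Subfunctor (Module.Grassmannian.functor (R := k) (M := gr d) c)) : Prop :=
  ∃ (x : L.toFunctor.obj (CommAlgCat.of k k))
    (eG : TangentIso (Module.Grassmannian.functor (R := k) (M := gr d) c)
      (L.ι.app _ x) (degPart gr P d →ₗ[k] gr d ⧸ degPart gr P d))
    (eL : TangentIso L.toFunctor x (homZero (R := R) (subGrade gr P) (quotGrade gr P))),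
    (show Module.Grassmannian k (k ⊗[k] gr d) c from x.1).toSubmodule =
      (degPart gr P d).baseChange k ∧
    IsCanonicalGrassIso (degPart gr P d) eG ∧
    Function.Injective (degComponent gr P d) ∧
    ∀ v : TangentSpace L.toFunctor x,
      eG.toEquiv (TangentSpace.differential L.ι x v) = degComponent gr P d (eL.toEquiv v)

end Tangent

end

end LevelAlgebra

open LevelAlgebra

/-!
The argument rests on the apolarity pairing `⟨u, F⟩ = (u • F)(0)` on `R × S`, for which
`⟨u v, F⟩ = ⟨u, v • F⟩`, forms of different degrees are orthogonal, and `R_i × S_i → k` is perfect.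
The inverse system `I⁻¹` is the orthogonal of `I`, and conversely. Levelness of `R / I` says that
`I⁻¹ = R Λ` with `Λ = (I⁻¹)_d` (`IsArtinLevel.prodSpan_eq`), equivalently that a class of degree
`i ≤ d` killed by all forms of degree `d - i` vanishes. Hence a homomorphism of degree `0` from
`I⁻¹` to `S / I⁻¹`, or from `I` to `R / I`, is determined by its component of degree `d`.

A first order deformation of `Λ` in the Grassmannian is the image of `Λ` under `1 + ε σ`, with `σ`
determined as a map `Λ → S_d / Λ`. The question is for which `σ` the ranks of the maps
`R_{d-i} ⊗ Λ → S_i` do not jump. If they do not, then every relation `∑ u_j F_j = 0` with `F_j ∈ Λ`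
implies `∑ u_j σ(F_j) ∈ R_{d-i} Λ = (I⁻¹)_i`, because otherwise some minor is `ε` times a unit
(`mem_prodSpan_of_minorIdeal_eq_bot`). Conversely, if `σ` extends to a homomorphism
`I⁻¹ → S / I⁻¹`, then the components of that homomorphism deform all `(I⁻¹)_i` compatibly, and the
image of the deformed map lies in a submodule with `dim (I⁻¹)_i` generators
(`minorIdeal_deform_eq_bot`).

The two extension problems, for `I⁻¹ → S / I⁻¹` and for `I → R / I`, are joined by the condition
`IsExtendable`: for each `u ∈ I` there is `a ∈ R` with `⟨u, v σ(F)⟩ = ⟨a, v F⟩` for all `v ∈ R` and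
`F ∈ Λ`. It makes `v F ↦ v σ(F)` well defined modulo `I⁻¹`, and it makes `u ↦ -a` a homomorphism
`I → R / I` whose component of degree `d` is the negative transpose of `σ`. As the orthogonal of
`(1 + ε σ) Λ` is `(1 - ε σᵗ) I_d` (`pairing_deformMap`), this settles the case of the Grassmannian
of subspaces of `R_d`.

The vector space structure on tangent spaces requires deformations over `k[ε₁, ε₂] / (ε₁, ε₂)²`; all
deformations are therefore built over an algebra with two elements `a, b` that span an ideal of
square zero, and those over the dual numbers are obtained by specialization
(`tangentSpaceIsHomZero_of`).
-/

namespace LevelAlgebra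

noncomputable section

open MvPolynomial TensorProduct CategoryTheory

universe u

attribute [local instance] MvPolynomial.gradedAlgebra

/-! ### First order deformations of a subspace -/

section Deform

variable {k : Type*} [Field k] {V : Type*} [AddCommGroup V] [Module k V]
  {B : Type*} [CommRing B] [Algebra k B]

/-- The pair `a, b` spans an ideal of square zero. -/
structure SqZeroPair (a b : B) : Prop where
  left : a * a = 0
  mixed : a * b = 0
  right : b * b = 0

/-- The endomorphism `1 + a τ₁ + b τ₂` of `B ⊗ V`. -/
def deformMap (a b : B) (τ₁ τ₂ : Module.End k V) : B ⊗[k] V →ₗ[B] B ⊗[k] V :=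
  LinearMap.id + a • τ₁.baseChange B + b • τ₂.baseChange B

theorem deformMap_tmul (a b c : B) (τ₁ τ₂ : Module.End k V) (F : V) :
    deformMap a b τ₁ τ₂ (c ⊗ₜ F) = c ⊗ₜ F + (a * c) ⊗ₜ τ₁ F + (b * c) ⊗ₜ τ₂ F := by
  simp [deformMap, smul_tmul']

theorem deformMap_one_tmul (a b : B) (τ₁ τ₂ : Module.End k V) (F : V) :
    deformMap a b τ₁ τ₂ (1 ⊗ₜ F) = 1 ⊗ₜ F + a ⊗ₜ τ₁ F + b ⊗ₜ τ₂ F := by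
  simp [deformMap_tmul]

theorem deformMap_neg_apply {a b : B} (h : SqZeroPair a b) (τ₁ τ₂ : Module.End k V)
    (x : B ⊗[k] V) : deformMap a b (-τ₁) (-τ₂) (deformMap a b τ₁ τ₂ x) = x := by
  induction x with
  | zero => simp
  | add x y hx hy => rw [map_add, map_add, hx, hy]
  | tmul c F =>
    simp only [deformMap_tmul, map_add, ← mul_assoc, h.left, h.mixed, h.right, mul_comm b a,
      LinearMap.neg_apply, tmul_neg, zero_mul, zero_tmul]
    abel

/-- `1 + a τ₁ + b τ₂` is an automorphism of `B ⊗ V` if `a` and `b` span an ideal of square zero. -/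
def deformEquiv {a b : B} (h : SqZeroPair a b) (τ₁ τ₂ : Module.End k V) :
    (B ⊗[k] V) ≃ₗ[B] B ⊗[k] V :=
  LinearEquiv.ofLinearMap (deformMap a b τ₁ τ₂) (deformMap a b (-τ₁) (-τ₂))
    (LinearMap.ext fun x => by simpa using deformMap_neg_apply h (-τ₁) (-τ₂) x)
    (LinearMap.ext fun x => deformMap_neg_apply h τ₁ τ₂ x)

theorem ker_baseChange_mkQ (Λ : Submodule k V) :
    LinearMap.ker (Λ.mkQ.baseChange B) = Λ.baseChange B := by
  ext x
  rw [LinearMap.mem_ker, Submodule.baseChange, LinearMap.mem_range]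
  exact lTensor_exact B (LinearMap.exact_subtype_mkQ Λ) (Submodule.mkQ_surjective _) x

/-- The quotient by the deformation `(1 + a τ₁ + b τ₂)(B ⊗ Λ)` is isomorphic to `B ⊗ (V / Λ)`. -/
def deformQuotEquiv {a b : B} (h : SqZeroPair a b) (τ₁ τ₂ : Module.End k V) (Λ : Submodule k V) :
    ((B ⊗[k] V) ⧸ (Λ.baseChange B).map (deformMap a b τ₁ τ₂)) ≃ₗ[B] B ⊗[k] (V ⧸ Λ) :=
  (Submodule.Quotient.equiv (Λ.baseChange B) _ (deformEquiv h τ₁ τ₂) rfl).symm.trans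
    ((Submodule.quotEquivOfEq _ _ (ker_baseChange_mkQ Λ).symm).trans
      (LinearMap.quotKerEquivOfSurjective (Λ.mkQ.baseChange B)
        (LinearMap.lTensor_surjective B (Submodule.mkQ_surjective Λ))))

/-- The deformation `(1 + a τ₁ + b τ₂)(B ⊗ Λ)` of a subspace `Λ ⊆ V`. -/
def deformPoint {a b : B} (h : SqZeroPair a b) (τ₁ τ₂ : Module.End k V) [FiniteDimensional k V]
    (Λ : Submodule k V) {c : ℕ} (hc : Module.finrank k (V ⧸ Λ) = c) :
    Module.Grassmannian B (B ⊗[k] V) c :=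
  { toSubmodule := (Λ.baseChange B).map (deformMap a b τ₁ τ₂)
    finite_quotient := Module.Finite.equiv (deformQuotEquiv h τ₁ τ₂ Λ).symm
    projective_quotient := Module.Projective.of_equiv (deformQuotEquiv h τ₁ τ₂ Λ).symm
    rankAtStalk_eq := fun p => by
      have : Nontrivial B := p.nontrivial
      rw [Module.rankAtStalk_eq_of_equiv (deformQuotEquiv h τ₁ τ₂ Λ),
        Module.rankAtStalk_eq_finrank_of_free, Module.finrank_baseChange]
      exact hc }

theorem deformPoint_toSubmodule {a b : B} (h : SqZeroPair a b) (τ₁ τ₂ : Module.End k V)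
    [FiniteDimensional k V] (Λ : Submodule k V) {c : ℕ} (hc : Module.finrank k (V ⧸ Λ) = c) :
    (deformPoint h τ₁ τ₂ Λ hc).toSubmodule = (Λ.baseChange B).map (deformMap a b τ₁ τ₂) := rfl

theorem map_deformMap_eq_span (a b : B) (τ₁ τ₂ : Module.End k V) (Λ : Submodule k V) :
    (Λ.baseChange B).map (deformMap a b τ₁ τ₂) =
      Submodule.span B ((fun F => 1 ⊗ₜ F + a ⊗ₜ τ₁ F + b ⊗ₜ τ₂ F) '' (Λ : Set V)) := by
  rw [Submodule.baseChange_eq_span, Submodule.map_span]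
  congr 1
  ext x
  simp [deformMap_one_tmul]

theorem deform_mem (a b : B) (τ₁ τ₂ : Module.End k V) {Λ : Submodule k V} {F : V} (hF : F ∈ Λ) :
    (1 : B) ⊗ₜ F + a ⊗ₜ τ₁ F + b ⊗ₜ τ₂ F ∈ (Λ.baseChange B).map (deformMap a b τ₁ τ₂) := by
  rw [map_deformMap_eq_span]
  exact Submodule.subset_span ⟨F, hF, rfl⟩

end Deform

section DeformMap

variable {k : Type*} [Field k] {V : Type*} [AddCommGroup V] [Module k V] [FiniteDimensional k V]
  {B B' : Type u} [CommRing B] [Algebra k B] [CommRing B'] [Algebra k B']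

theorem map_deformPoint (f : B →ₐ[k] B') {a b : B} (h : SqZeroPair a b) {a' b' : B'}
    (h' : SqZeroPair a' b') (ha : f a = a') (hb : f b = b')
    (τ₁ τ₂ : Module.End k V) (Λ : Submodule k V) {c : ℕ} (hc : Module.finrank k (V ⧸ Λ) = c) :
    Module.Grassmannian.map f (deformPoint h τ₁ τ₂ Λ hc) = deformPoint h' τ₁ τ₂ Λ hc := by
  apply Module.Grassmannian.ext
  rw [map_eq_span, deformPoint_toSubmodule, deformPoint_toSubmodule,
    map_deformMap_eq_span a' b' τ₁ τ₂ Λ]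
  apply le_antisymm
  · rw [Submodule.span_le]
    rintro _ ⟨x, hx, rfl⟩
    rw [map_deformMap_eq_span] at hx
    induction hx using Submodule.span_induction with
    | mem x hx =>
      obtain ⟨F, hF, rfl⟩ := hx
      refine Submodule.subset_span ⟨F, hF, ?_⟩
      simp [ha, hb]
    | zero => simp
    | add x y _ _ hx hy => rw [map_add]; exact add_mem hx hy
    | smul c x _ hx => rw [scalarMap_smul]; exact Submodule.smul_mem _ _ hx
  · refine Submodule.span_mono ?_
    rintro _ ⟨F, hF, rfl⟩
    refine ⟨_, deform_mem a b τ₁ τ₂ hF, ?_⟩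
    simp [ha, hb]

theorem deformPoint_congr {a b a' b' : B} (h : SqZeroPair a b) (h' : SqZeroPair a' b')
    (τ₁ τ₂ τ₁' τ₂' : Module.End k V) (Λ : Submodule k V) {c : ℕ}
    (hc : Module.finrank k (V ⧸ Λ) = c)
    (hτ : ∀ F, a ⊗ₜ[k] τ₁ F + b ⊗ₜ[k] τ₂ F = a' ⊗ₜ[k] τ₁' F + b' ⊗ₜ[k] τ₂' F) :
    deformPoint h τ₁ τ₂ Λ hc = deformPoint h' τ₁' τ₂' Λ hc := by
  apply Module.Grassmannian.ext
  rw [deformPoint_toSubmodule, deformPoint_toSubmodule]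
  congr 1
  refine TensorProduct.AlgebraTensorModule.curry_injective ?_
  ext F
  simp [deformMap_one_tmul, add_assoc, hτ]

end DeformMap

/-! ### Points of a Grassmannian over the dual numbers -/

section Dual

variable {k : Type u} [Field k] {V : Type u} [AddCommGroup V] [Module k V]

theorem exists_dual_decomp (x : DualNumber k ⊗[k] V) :
    ∃ F G : V, x = (1 : DualNumber k) ⊗ₜ F + (DualNumber.eps : DualNumber k) ⊗ₜ G := by
  induction x with
  | zero => exact ⟨0, 0, by simp⟩
  | add x y hx hy =>
    obtain ⟨F, G, rfl⟩ := hx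
    obtain ⟨F', G', rfl⟩ := hy
    exact ⟨F + F', G + G', by simp only [tmul_add]; abel⟩
  | tmul c F =>
    refine ⟨c.fst • F, c.snd • F, ?_⟩
    rw [← smul_tmul, ← smul_tmul, ← add_tmul]
    congr 1
    ext <;> simp

theorem exists_sqZero_decomp (x : TrivSqZeroExt k (k × k) ⊗[k] V) :
    ∃ F G H : V, x = (1 : TrivSqZeroExt k (k × k)) ⊗ₜ F +
      (TrivSqZeroExt.inr (1, 0) : TrivSqZeroExt k (k × k)) ⊗ₜ G +
      (TrivSqZeroExt.inr (0, 1) : TrivSqZeroExt k (k × k)) ⊗ₜ H := by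
  induction x with
  | zero => exact ⟨0, 0, 0, by simp⟩
  | add x y hx hy =>
    obtain ⟨F, G, H, rfl⟩ := hx
    obtain ⟨F', G', H', rfl⟩ := hy
    exact ⟨F + F', G + G', H + H', by simp only [tmul_add]; abel⟩
  | tmul c F =>
    refine ⟨c.fst • F, c.snd.1 • F, c.snd.2 • F, ?_⟩
    rw [← smul_tmul, ← smul_tmul, ← smul_tmul, ← add_tmul, ← add_tmul]
    congr 1
    ext <;> simp

theorem tmul_one_mem_baseChange {Λ : Submodule k V} {F : V} :
    (1 : k) ⊗ₜ[k] F ∈ Λ.baseChange k ↔ F ∈ Λ := by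
  rw [← ker_baseChange_mkQ, LinearMap.mem_ker, LinearMap.baseChange_tmul,
    ← Submodule.Quotient.mk_eq_zero]
  constructor
  · intro h
    simpa using congrArg (TensorProduct.lid k _) h
  · intro h
    rw [Submodule.mkQ_apply, h, tmul_zero]

/-- Every element of a specialization along a map `B → k` lifts: the image of `N` generates and is
already a subspace. -/
theorem exists_lift_of_map_eq {B : Type u} [CommRing B] [Algebra k B] (f : B →ₐ[k] k) {c : ℕ}
    (N : Module.Grassmannian B (B ⊗[k] V) c) {Λ : Submodule k V}
    (hN : (Module.Grassmannian.map f N).toSubmodule = Λ.baseChange k) {F : V} (hF : F ∈ Λ) :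
    ∃ x ∈ N.toSubmodule, scalarMap f V x = 1 ⊗ₜ F := by
  have h1 : (1 : k) ⊗ₜ[k] F ∈ Submodule.span k (scalarMap f V '' (N.toSubmodule : Set _)) := by
    rw [← map_eq_span, hN]
    exact tmul_one_mem_baseChange.mpr hF
  generalize (1 : k) ⊗ₜ[k] F = y at h1 ⊢
  induction h1 using Submodule.span_induction with
  | mem x hx => exact hx
  | zero => exact ⟨0, zero_mem _, map_zero _⟩
  | add x y _ _ hx hy =>
    obtain ⟨x, hx, rfl⟩ := hx
    obtain ⟨y, hy, rfl⟩ := hy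
    exact ⟨x + y, add_mem hx hy, map_add _ _ _⟩
  | smul c x _ hx =>
    obtain ⟨x, hx, rfl⟩ := hx
    exact ⟨c • x, Submodule.smul_of_tower_mem _ c hx, map_smul _ _ _⟩

theorem tmul_one_injective {F G : V} (h : (1 : k) ⊗ₜ[k] F = 1 ⊗ₜ G) : F = G := by
  simpa using congrArg (TensorProduct.lid k _) h

variable {c : ℕ} (N : Module.Grassmannian (DualNumber k) (DualNumber k ⊗[k] V) c)
  {Λ : Submodule k V}
  (hN : (Module.Grassmannian.map (TrivSqZeroExt.fstHom k k k) N).toSubmodule = Λ.baseChange k)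
include hN

theorem left_mem_of_dual_mem {F G : V}
    (h : (1 : DualNumber k) ⊗ₜ F + (DualNumber.eps : DualNumber k) ⊗ₜ G ∈ N.toSubmodule) :
    F ∈ Λ := by
  have := scalarMap_mem (TrivSqZeroExt.fstHom k k k) N h
  rw [hN] at this
  simpa [tmul_one_mem_baseChange] using this

theorem exists_dual_mem {F : V} (hF : F ∈ Λ) :
    ∃ G : V, (1 : DualNumber k) ⊗ₜ F + (DualNumber.eps : DualNumber k) ⊗ₜ G ∈ N.toSubmodule := by
  obtain ⟨x, hx, h⟩ := exists_lift_of_map_eq _ N hN hF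
  obtain ⟨F', G, rfl⟩ := exists_dual_decomp x
  have : F' = F := tmul_one_injective (by simpa using h)
  exact ⟨G, this ▸ hx⟩

/-- Flatness of the quotient: `ε G` lies in the deformed subspace only if `G` lies in the original
one. -/
theorem eps_tmul_mem_iff {G : V} :
    (DualNumber.eps : DualNumber k) ⊗ₜ G ∈ N.toSubmodule ↔ G ∈ Λ := by
  constructor
  · intro h
    -- a projective module embeds into a free one, where the annihilator of `ε` is `ε` times all
    have := N.projective_quotient
    obtain ⟨s, hs⟩ := Module.projective_def.mp this
    set q := N.toSubmodule.mkQ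
    have h0 : (DualNumber.eps : DualNumber k) • q (1 ⊗ₜ G) = 0 := by
      rw [← map_smul, smul_tmul', smul_eq_mul, mul_one]
      exact (Submodule.Quotient.mk_eq_zero _).mpr h
    have h1 : (DualNumber.eps : DualNumber k) • s (q (1 ⊗ₜ G)) = 0 := by
      rw [← map_smul, h0, map_zero]
    have h2 : ∀ z : DualNumber k, DualNumber.eps * z = 0 →
        z = DualNumber.eps * TrivSqZeroExt.inl z.snd := by
      intro z hz
      have h3 : z.fst = 0 := by simpa using congrArg TrivSqZeroExt.snd hz
      ext <;> simp [h3]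
    obtain ⟨y, hy⟩ : ∃ y, s (q (1 ⊗ₜ G)) = (DualNumber.eps : DualNumber k) • y := by
      refine ⟨Finsupp.mapRange (fun z : DualNumber k => TrivSqZeroExt.inl z.snd) (by simp)
        (s (q (1 ⊗ₜ G))), Finsupp.ext fun i => ?_⟩
      have := h2 (s (q (1 ⊗ₜ G)) i) (by simpa using DFunLike.congr_fun h1 i)
      exact this
    have h4 : q (1 ⊗ₜ G) = (DualNumber.eps : DualNumber k) •
        Finsupp.linearCombination (DualNumber k) id y := by
      rw [← map_smul, ← hy, hs]
    obtain ⟨w, hw⟩ := Submodule.mkQ_surjective _ (Finsupp.linearCombination (DualNumber k) id y)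
    rw [← hw, ← map_smul, ← sub_eq_zero, ← map_sub] at h4
    have h5 : (1 : DualNumber k) ⊗ₜ G - (DualNumber.eps : DualNumber k) • w ∈ N.toSubmodule :=
      (Submodule.Quotient.mk_eq_zero _).mp h4
    obtain ⟨F', G', rfl⟩ := exists_dual_decomp w
    have h6 : (1 : DualNumber k) ⊗ₜ G + (DualNumber.eps : DualNumber k) ⊗ₜ[k] (-F') ∈
        N.toSubmodule := by
      convert h5 using 1
      simp [smul_tmul', tmul_neg, sub_eq_add_neg]
    exact left_mem_of_dual_mem N hN h6
  · intro h
    obtain ⟨G', hG⟩ := exists_dual_mem N hN h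
    have := N.toSubmodule.smul_mem (DualNumber.eps : DualNumber k) hG
    simpa [smul_tmul'] using this

/-- The linear map `Λ → V / Λ` that describes a first order deformation of `Λ`. -/
theorem exists_tangentHom : ∃ τ : Λ →ₗ[k] V ⧸ Λ, ∀ (F : Λ) (G : V),
    (1 : DualNumber k) ⊗ₜ (F : V) + (DualNumber.eps : DualNumber k) ⊗ₜ G ∈ N.toSubmodule ↔
      τ F = Submodule.Quotient.mk G := by
  choose g hg using fun F : Λ => exists_dual_mem N hN F.2
  have key : ∀ (F : Λ) (G : V),
      (1 : DualNumber k) ⊗ₜ (F : V) + (DualNumber.eps : DualNumber k) ⊗ₜ G ∈ N.toSubmodule ↔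
        (Submodule.Quotient.mk (g F) : V ⧸ Λ) = Submodule.Quotient.mk G := by
    intro F G
    rw [Submodule.Quotient.eq, ← eps_tmul_mem_iff N hN, tmul_sub,
      ← N.toSubmodule.sub_mem_iff_right (hg F)]
    convert Iff.rfl using 2
    abel
  refine ⟨{ toFun := fun F => Submodule.Quotient.mk (g F), map_add' := ?_, map_smul' := ?_ }, key⟩
  · intro F F'
    rw [← Submodule.Quotient.mk_add, ← key]
    have := add_mem (hg F) (hg F')
    convert this using 1
    simp only [Submodule.coe_add, tmul_add]
    abel
  · intro c F
    rw [RingHom.id_apply, ← Submodule.Quotient.mk_smul, ← key]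
    have := N.toSubmodule.smul_of_tower_mem c (hg F)
    convert this using 1
    simp

theorem eq_of_dual_mem_iff (N' : Module.Grassmannian (DualNumber k) (DualNumber k ⊗[k] V) c)
    (hN' : (Module.Grassmannian.map (TrivSqZeroExt.fstHom k k k) N').toSubmodule = Λ.baseChange k)
    (h : ∀ (F : Λ) (G : V),
      (1 : DualNumber k) ⊗ₜ (F : V) + (DualNumber.eps : DualNumber k) ⊗ₜ G ∈ N.toSubmodule ↔
      (1 : DualNumber k) ⊗ₜ (F : V) + (DualNumber.eps : DualNumber k) ⊗ₜ G ∈ N'.toSubmodule) :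
    N = N' := by
  apply Module.Grassmannian.ext
  ext x
  obtain ⟨F, G, rfl⟩ := exists_dual_decomp x
  constructor
  · intro hx
    exact (h ⟨F, left_mem_of_dual_mem N hN hx⟩ G).mp hx
  · intro hx
    exact (h ⟨F, left_mem_of_dual_mem N' hN' hx⟩ G).mpr hx

end Dual

/-! ### Minors of the product maps -/

section MinorLemmas

/-- If the image of `f` lies in a submodule with `r` generators, then the `(r + 1) × (r + 1)` minors
of `f` are determinants of products of matrices through `B ^ r`, hence vanish. -/
theorem minorIdeal_eq_bot_of_range_le {B M P : Type*} [CommRing B] [AddCommMonoid M]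
    [Module B M] [AddCommMonoid P] [Module B P] (f : M →ₗ[B] P) {r : ℕ} (q : Fin r → P)
    (hf : ∀ x, f x ∈ Submodule.span B (Set.range q)) : minorIdeal f (r + 1) = ⊥ := by
  rw [minorIdeal, Ideal.span_eq_bot]
  rintro _ ⟨⟨w, ξ⟩, rfl⟩
  choose m hm using fun b => (Submodule.mem_span_range_iff_exists_fun B).mp (hf (w b))
  -- the factors are made square by a column and a row of zeros
  have : (Matrix.of fun a b => ξ a (f (w b))) =
      (Matrix.of fun a c => ξ a ((Fin.snoc q 0 : Fin (r + 1) → P) c)) *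
      (Matrix.of fun c b => (Fin.snoc (m b) 0 : Fin (r + 1) → B) c) := by
    ext a b
    rw [Matrix.mul_apply, Fin.sum_univ_castSucc]
    simp [← hm, map_sum, mul_comm]
  change (Matrix.of fun a b => ξ a (f (w b))).det = 0
  rw [this, Matrix.det_mul, Matrix.det_eq_zero_of_column_eq_zero (Fin.last r) (by simp), zero_mul]

theorem exists_dual_family {k W : Type*} [Field k] [AddCommGroup W] [Module k W] {ι : Type*}
    [DecidableEq ι] {g : ι → W} (hg : LinearIndependent k g) :
    ∃ ξ : ι → Module.Dual k W, ∀ i j, ξ i (g j) = if i = j then 1 else 0 := by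
  choose ξ hξ using fun i => LinearMap.exists_extend (Finsupp.lapply i ∘ₗ hg.repr)
  refine ⟨ξ, fun i j => ?_⟩
  have := LinearMap.congr_fun (hξ i) ⟨g j, Submodule.subset_span ⟨j, rfl⟩⟩
  have h2 := hg.repr_eq_single j ⟨g j, Submodule.subset_span ⟨j, rfl⟩⟩ rfl
  simp only [LinearMap.comp_apply, Submodule.subtype_apply, h2] at this
  rw [this]
  simp [Finsupp.single_apply, eq_comm]

/-- An ideal of a `k`-algebra that becomes the unit ideal over `k` is the unit ideal if the kernel
consists of nilpotent elements. -/
theorem eq_top_of_map_eq_top {k B : Type*} [Field k] [CommRing B] [Algebra k B] (f : B →ₐ[k] k)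
    (hf : ∀ x, f x = 0 → IsNilpotent x) (J : Ideal B) (hJ : J.map f = ⊤) : J = ⊤ := by
  have hs : Function.Surjective f := fun y => ⟨algebraMap k B y, by simp⟩
  have h1 : (1 : k) ∈ J.map f := hJ ▸ Submodule.mem_top
  obtain ⟨j, hj, h⟩ := (Ideal.mem_map_iff_of_surjective f hs).mp h1
  have : IsUnit j := by
    have h2 := (hf (1 - j) (by simp [h])).isUnit_one_sub
    simpa using h2
  exact Ideal.eq_top_of_isUnit_mem _ hj this

variable {k : Type*} [Field k] {U V W : Type*} [AddCommGroup U] [Module k U]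
  [AddCommGroup V] [Module k V] [AddCommGroup W] [Module k W]

/-- The subspace `U · Λ` of `W`. -/
def prodSpan (c : U →ₗ[k] V →ₗ[k] W) (Λ : Submodule k V) : Submodule k W :=
  Submodule.span k {x | ∃ u, ∃ F ∈ Λ, c u F = x}

theorem mem_prodSpan (c : U →ₗ[k] V →ₗ[k] W) {Λ : Submodule k V} (u : U) {F : V} (hF : F ∈ Λ) :
    c u F ∈ prodSpan c Λ :=
  Submodule.subset_span ⟨u, F, hF, rfl⟩

theorem exists_products_basis [FiniteDimensional k W] (c : U →ₗ[k] V →ₗ[k] W)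
    (Λ : Submodule k V) : ∃ (u : Fin (Module.finrank k (prodSpan c Λ)) → U)
      (F : Fin (Module.finrank k (prodSpan c Λ)) → V), (∀ i, F i ∈ Λ) ∧
      Submodule.span k (Set.range fun i => c (u i) (F i)) = prodSpan c Λ ∧
      LinearIndependent k fun i => c (u i) (F i) := by
  obtain ⟨f, hf, hs, hli⟩ := Submodule.exists_fun_fin_finrank_span_eq k
    {x | ∃ u, ∃ F ∈ Λ, c u F = x}
  choose u F hF huF using hf
  obtain rfl : (fun i => c (u i) (F i)) = f := funext huF
  exact ⟨u, F, hF, hs, hli⟩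

/-- Over the field itself, the rank of the product map is the dimension of `U · Λ`. -/
theorem minorIdeal_baseChange_eq_top [FiniteDimensional k W] (c : U →ₗ[k] V →ₗ[k] W)
    (Λ : Submodule k V) :
    minorIdeal (productMap c (Λ.baseChange k)) (Module.finrank k (prodSpan c Λ)) = ⊤ := by
  obtain ⟨u, F, hF, -, hli⟩ := exists_products_basis c Λ
  obtain ⟨ξ, hξ⟩ := exists_dual_family hli
  rw [Ideal.eq_top_iff_one]
  refine Ideal.subset_span ⟨⟨fun b => ⟨(1 : k) ⊗ₜ F b,
    Submodule.tmul_mem_baseChange_of_mem 1 (hF b)⟩ ⊗ₜ u b, fun a => (ξ a).liftBaseChange k⟩, ?_⟩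
  convert Matrix.det_one (n := Fin (Module.finrank k (prodSpan c Λ))) (R := k)
  ext a b
  simp [Matrix.one_apply, hξ]

variable {B : Type*} [CommRing B] [Algebra k B]

theorem productMap_mem (c : U →ₗ[k] V →ₗ[k] W) (N : Submodule B (B ⊗[k] V))
    (Q : Submodule B (B ⊗[k] W)) (h : ∀ u, ∀ y ∈ N, (c u).baseChange B y ∈ Q) (x : N ⊗[k] U) :
    productMap c N x ∈ Q := by
  induction x with
  | zero => simp
  | add x y hx hy => rw [map_add]; exact add_mem hx hy
  | tmul y u => exact h u y y.2

/-- The rank of the product map does not jump along a first order deformation of `Λ` if the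
deformation is compatible with a deformation of a subspace `Λ'` that contains the products. -/
theorem minorIdeal_deform_eq_bot {a b : B} (hab : SqZeroPair a b) (c : U →ₗ[k] V →ₗ[k] W)
    (Λ : Submodule k V) (Λ' : Submodule k W) [FiniteDimensional k Λ']
    (τ₁ τ₂ : Module.End k V) (σ₁ σ₂ : Module.End k W) (N : Submodule B (B ⊗[k] V))
    (hN : N = (Λ.baseChange B).map (deformMap a b τ₁ τ₂))
    (h : ∀ u, ∀ F ∈ Λ, c u F ∈ Λ')
    (h₁ : ∀ u, ∀ F ∈ Λ, c u (τ₁ F) - σ₁ (c u F) ∈ Λ')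
    (h₂ : ∀ u, ∀ F ∈ Λ, c u (τ₂ F) - σ₂ (c u F) ∈ Λ') :
    minorIdeal (productMap c N) (Module.finrank k Λ' + 1) = ⊥ := by
  obtain ⟨e, he⟩ : ∃ e : Fin (Module.finrank k Λ') → W, Submodule.span k (Set.range e) = Λ' := by
    refine ⟨fun i => Module.finBasis k Λ' i, ?_⟩
    have := congrArg (Submodule.map Λ'.subtype) (Module.finBasis k Λ').span_eq
    rwa [Submodule.map_span, ← Set.range_comp, Submodule.map_subtype_top] at this
  let s : W →ₗ[k] B ⊗[k] W :=
    (deformMap a b σ₁ σ₂).restrictScalars k ∘ₗ TensorProduct.mk k B W 1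
  have hs : ∀ F, s F = 1 ⊗ₜ F + a ⊗ₜ σ₁ F + b ⊗ₜ σ₂ F := deformMap_one_tmul a b σ₁ σ₂
  clear_value s
  let Q := Submodule.span B (Set.range fun i => s (e i))
  have hQ : ∀ F ∈ Λ', s F ∈ Q := by
    intro F hF
    rw [← he] at hF
    induction hF using Submodule.span_induction with
    | mem x hx =>
      obtain ⟨i, rfl⟩ := hx
      exact Submodule.subset_span ⟨i, rfl⟩
    | zero => simp
    | add x y _ _ hx hy => rw [map_add]; exact add_mem hx hy
    | smul c x _ hx => rw [map_smul]; exact Submodule.smul_of_tower_mem _ c hx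
  have hQa : ∀ F ∈ Λ', a ⊗ₜ F ∈ Q := by
    intro F hF
    have := Q.smul_mem a (hQ F hF)
    simpa [hs, smul_tmul', hab.left, hab.mixed] using this
  have hQb : ∀ F ∈ Λ', b ⊗ₜ F ∈ Q := by
    intro F hF
    have := Q.smul_mem b (hQ F hF)
    simpa [hs, smul_tmul', hab.right, mul_comm b a, hab.mixed] using this
  refine minorIdeal_eq_bot_of_range_le _ (fun i => s (e i)) fun x => ?_
  refine productMap_mem c _ Q (fun u y hy => ?_) x
  rw [hN, map_deformMap_eq_span] at hy
  induction hy using Submodule.span_induction with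
  | mem x hx =>
    obtain ⟨F, hF, rfl⟩ := hx
    have h3 := add_mem (add_mem (hQ _ (h u F hF)) (hQa _ (h₁ u F hF))) (hQb _ (h₂ u F hF))
    have h4 : (c u).baseChange B (1 ⊗ₜ F + a ⊗ₜ τ₁ F + b ⊗ₜ τ₂ F) =
        s (c u F) + a ⊗ₜ (c u (τ₁ F) - σ₁ (c u F)) + b ⊗ₜ (c u (τ₂ F) - σ₂ (c u F)) := by
      simp only [map_add, LinearMap.baseChange_tmul, hs, tmul_sub]
      abel
    rw [h4]
    exact h3
  | zero => simp
  | add x y _ _ hx hy => rw [map_add]; exact add_mem hx hy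
  | smul c x _ hx => rw [map_smul]; exact Submodule.smul_mem _ _ hx

end MinorLemmas

section DualMinors

variable {k : Type u} [Field k] {U V W : Type u} [AddCommGroup U] [Module k U]
  [AddCommGroup V] [Module k V] [AddCommGroup W] [Module k W]

/-- The first order condition for the vanishing of minors: if the rank of the product map does not
jump along a deformation of `Λ` over the dual numbers, then products of the deformation that are
divisible by `ε` are so with a quotient in `U · Λ`. Otherwise a quotient `G` outside `U · Λ`
together with a basis of `U · Λ` gives a minor `ε · (unit)`. -/
theorem mem_prodSpan_of_minorIdeal_eq_bot [FiniteDimensional k W] (c : U →ₗ[k] V →ₗ[k] W) {e : ℕ}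
    (N : Module.Grassmannian (DualNumber k) (DualNumber k ⊗[k] V) e) {Λ : Submodule k V}
    (hN : (Module.Grassmannian.map (TrivSqZeroExt.fstHom k k k) N).toSubmodule = Λ.baseChange k)
    (hr : minorIdeal (productMap c N.toSubmodule) (Module.finrank k (prodSpan c Λ) + 1) = ⊥)
    (z : N.toSubmodule ⊗[k] U) {G : W}
    (hz : productMap c N.toSubmodule z = (DualNumber.eps : DualNumber k) ⊗ₜ G) :
    G ∈ prodSpan c Λ := by
  by_contra hG
  obtain ⟨u, F, hF, hspan, hli⟩ := exists_products_basis c Λ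
  choose F' hF' using fun b => exists_dual_mem N hN (hF b)
  have hli' : LinearIndependent k (Fin.cons G fun i => c (u i) (F i) : Fin (_ + 1) → W) :=
    hli.finCons (by rwa [hspan])
  obtain ⟨ξ, hξ⟩ := exists_dual_family hli'
  let E (a) : Module.Dual (DualNumber k) (DualNumber k ⊗[k] W) :=
    (Algebra.linearMap k (DualNumber k) ∘ₗ ξ a).liftBaseChange (DualNumber k)
  let w : Fin (Module.finrank k (prodSpan c Λ) + 1) → N.toSubmodule ⊗[k] U :=
    Fin.cons z (fun b => ⟨_, hF' b⟩ ⊗ₜ u b)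
  have hdet : (Matrix.of fun a b => E a (productMap c N.toSubmodule (w b))).det = 0 := by
    have : (Matrix.of fun a b => E a (productMap c N.toSubmodule (w b))).det ∈
        minorIdeal (productMap c N.toSubmodule) (Module.finrank k (prodSpan c Λ) + 1) :=
      Ideal.subset_span ⟨⟨w, E⟩, rfl⟩
    rwa [hr] at this
  have hcol : ∀ a, E a (productMap c N.toSubmodule (w 0)) =
      if a = 0 then DualNumber.eps else 0 := by
    intro a
    have h1 := hξ a 0
    rw [Fin.cons_zero] at h1
    simp only [w, Fin.cons_zero, hz, E, LinearMap.liftBaseChange_tmul, LinearMap.comp_apply, h1]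
    split_ifs <;> simp
  rw [Matrix.det_succ_column_zero, Finset.sum_eq_single 0] at hdet
  · simp only [Matrix.of_apply, hcol] at hdet
    have h2 := congrArg TrivSqZeroExt.snd hdet
    have h3 : TrivSqZeroExt.fst (Matrix.det ((Matrix.of fun a b =>
        E a (productMap c N.toSubmodule (w b))).submatrix (Fin.succAbove 0) Fin.succ)) = 1 := by
      have h4 := (TrivSqZeroExt.fstHom k k k : DualNumber k →+* k).map_det ((Matrix.of fun a b =>
        E a (productMap c N.toSubmodule (w b))).submatrix (Fin.succAbove 0) Fin.succ)
      refine Eq.trans h4 ?_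
      convert Matrix.det_one (n := Fin (Module.finrank k (prodSpan c Λ))) (R := k)
      ext a b
      have h1 := hξ a.succ b.succ
      rw [Fin.cons_succ] at h1
      simp only [w, E, RingHom.mapMatrix_apply, Matrix.map_apply, Matrix.submatrix_apply,
        Matrix.of_apply, Fin.cons_succ, Fin.succAbove_zero, productMap_tmul]
      simp [h1, Matrix.one_apply]
      split_ifs <;> simp
    rw [Fin.succAbove_zero] at h3
    simp at h2
    exact one_ne_zero (h3.symm.trans h2)
  · intro a _ ha
    simp [hcol, ha]
  · simp

end DualMinors

/-! ### Tangent spaces of subfunctors of a Grassmannian -/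

section Tangent

variable {k : Type u} [Field k] {V : Type u} [AddCommGroup V] [Module k V]

theorem sqZeroPair_eps : SqZeroPair (DualNumber.eps : DualNumber k) 0 :=
  ⟨DualNumber.eps_mul_eps, mul_zero _, mul_zero _⟩

theorem sqZeroPair_inr : SqZeroPair (TrivSqZeroExt.inr (1, 0) : TrivSqZeroExt k (k × k))
    (TrivSqZeroExt.inr (0, 1)) :=
  ⟨TrivSqZeroExt.inr_mul_inr _ _ _, TrivSqZeroExt.inr_mul_inr _ _ _,
    TrivSqZeroExt.inr_mul_inr _ _ _⟩

theorem sqZeroPair_zero : SqZeroPair (0 : k) 0 := ⟨mul_zero _, mul_zero _, mul_zero _⟩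

theorem deformPoint_zero_toSubmodule [FiniteDimensional k V] (τ₁ τ₂ : Module.End k V)
    (Λ : Submodule k V) {c : ℕ} (hc : Module.finrank k (V ⧸ Λ) = c) :
    (deformPoint sqZeroPair_zero τ₁ τ₂ Λ hc).toSubmodule = Λ.baseChange k := by
  have : deformMap (0 : k) 0 τ₁ τ₂ = LinearMap.id := by simp [deformMap]
  rw [deformPoint_toSubmodule, this, Submodule.map_id]

/-- Every linear map `Λ → V / Λ` is induced by an endomorphism of `V`. -/
theorem exists_end_lift (Λ : Submodule k V) (τ : Λ →ₗ[k] V ⧸ Λ) :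
    ∃ τ' : Module.End k V, Λ.mkQ ∘ₗ τ' ∘ₗ Λ.subtype = τ := by
  obtain ⟨τ₁, h₁⟩ := LinearMap.exists_extend τ
  obtain ⟨s, hs⟩ := LinearMap.exists_rightInverse_of_surjective Λ.mkQ
    (LinearMap.range_eq_top.mpr (Submodule.mkQ_surjective Λ))
  refine ⟨s ∘ₗ τ₁, ?_⟩
  rw [← h₁, LinearMap.comp_assoc, ← LinearMap.comp_assoc, hs, LinearMap.id_comp]

section Grass

variable {c : ℕ} {Λ : Submodule k V}
  {x : (Module.Grassmannian.functor (R := k) (M := V) c).obj (CommAlgCat.of k k)}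

/-- The subspace over the dual numbers that underlies a tangent vector of the Grassmannian. -/
def tangentPoint (v : TangentSpace (Module.Grassmannian.functor (R := k) (M := V) c) x) :
    Module.Grassmannian (DualNumber k) (DualNumber k ⊗[k] V) c := v.1

theorem map_tangentPoint
    (hx : (show Module.Grassmannian k (k ⊗[k] V) c from x).toSubmodule = Λ.baseChange k)
    (v : TangentSpace (Module.Grassmannian.functor (R := k) (M := V) c) x) :
    (Module.Grassmannian.map (TrivSqZeroExt.fstHom k k k) (tangentPoint v)).toSubmodule =
      Λ.baseChange k := by
  rw [← hx]
  exact congrArg Module.Grassmannian.toSubmodule v.2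

/-- The tangent vector given by the deformation `(1 + ε τ) Λ`. -/
def tangentOf
    (hx : (show Module.Grassmannian k (k ⊗[k] V) c from x).toSubmodule = Λ.baseChange k)
    [FiniteDimensional k V] (hc : Module.finrank k (V ⧸ Λ) = c)
    (τ : Module.End k V) :
    TangentSpace (Module.Grassmannian.functor (R := k) (M := V) c) x :=
  ⟨deformPoint sqZeroPair_eps τ 0 Λ hc, by
    refine (map_deformPoint (TrivSqZeroExt.fstHom k k k) sqZeroPair_eps sqZeroPair_zero
      (TrivSqZeroExt.fst_inr k 1) (map_zero _) τ 0 Λ hc).trans ?_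
    apply Module.Grassmannian.ext
    rw [deformPoint_zero_toSubmodule]
    exact hx.symm⟩

theorem tangentOf_apply
    (hx : (show Module.Grassmannian k (k ⊗[k] V) c from x).toSubmodule = Λ.baseChange k)
    [FiniteDimensional k V] (hc : Module.finrank k (V ⧸ Λ) = c)
    {e : TangentSpace (Module.Grassmannian.functor (R := k) (M := V) c) x → (Λ →ₗ[k] V ⧸ Λ)}
    (he : ∀ v (F : Λ) (G : V), (1 : DualNumber k) ⊗ₜ[k] (F : V) +
      (DualNumber.eps : DualNumber k) ⊗ₜ[k] G ∈ (tangentPoint v).toSubmodule ↔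
        e v F = Submodule.Quotient.mk G) (τ : Module.End k V) :
    e (tangentOf hx hc τ) = Λ.mkQ ∘ₗ τ ∘ₗ Λ.subtype := by
  ext F
  refine (he _ F (τ F)).mp ?_
  have := deform_mem (DualNumber.eps : DualNumber k) 0 τ 0 F.2
  rw [zero_tmul, add_zero] at this
  exact this

theorem map_sqZero_deformPoint
    [FiniteDimensional k V] (hc : Module.finrank k (V ⧸ Λ) = c)
    (g : k × k →ₗ[k] k) (τ₁ τ₂ : Module.End k V) :
    Module.Grassmannian.map (TrivSqZeroExt.map g) (deformPoint sqZeroPair_inr τ₁ τ₂ Λ hc) =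
      deformPoint sqZeroPair_eps (g (1, 0) • τ₁ + g (0, 1) • τ₂) 0 Λ hc := by
  have h1 : SqZeroPair (TrivSqZeroExt.inr (g (1, 0)) : DualNumber k)
      (TrivSqZeroExt.inr (g (0, 1))) :=
    ⟨TrivSqZeroExt.inr_mul_inr _ _ _, TrivSqZeroExt.inr_mul_inr _ _ _,
      TrivSqZeroExt.inr_mul_inr _ _ _⟩
  rw [map_deformPoint (TrivSqZeroExt.map g) sqZeroPair_inr h1 (by simp) (by simp)]
  refine deformPoint_congr _ _ _ _ _ _ Λ hc fun F => ?_
  have h2 : ∀ a : k, (TrivSqZeroExt.inr a : DualNumber k) = a • DualNumber.eps := by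
    intro a
    ext <;> simp
  rw [h2, h2]
  simp [tmul_add, smul_tmul]

/-- A deformation over `k[ε₁, ε₂] / (ε₁, ε₂)²` restricts to two tangent vectors and to their sum. -/
theorem hom_eq_add_of_isSum
    (hx : (show Module.Grassmannian k (k ⊗[k] V) c from x).toSubmodule = Λ.baseChange k)
    {e : TangentSpace (Module.Grassmannian.functor (R := k) (M := V) c) x → (Λ →ₗ[k] V ⧸ Λ)}
    (he : ∀ v (F : Λ) (G : V), (1 : DualNumber k) ⊗ₜ[k] (F : V) +
      (DualNumber.eps : DualNumber k) ⊗ₜ[k] G ∈ (tangentPoint v).toSubmodule ↔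
        e v F = Submodule.Quotient.mk G)
    {u v w : TangentSpace (Module.Grassmannian.functor (R := k) (M := V) c) x}
    (h : TangentSpace.IsSum u v w) : e w = e u + e v := by
  obtain ⟨z, hu, hv, hw⟩ := h
  let N : Module.Grassmannian (TrivSqZeroExt k (k × k)) (TrivSqZeroExt k (k × k) ⊗[k] V) c := z
  have hN : (Module.Grassmannian.map (TrivSqZeroExt.fstHom k k (k × k)) N).toSubmodule =
      Λ.baseChange k := by
    have h1 : TrivSqZeroExt.fstHom k k (k × k) =
        (TrivSqZeroExt.fstHom k k k).comp (TrivSqZeroExt.map (LinearMap.fst k k k)) := by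
      ext <;> simp
    rw [h1, Module.Grassmannian.map_comp]
    have h2 : Module.Grassmannian.map (TrivSqZeroExt.map (LinearMap.fst k k k)) N =
      tangentPoint u := hu
    rw [h2]
    exact map_tangentPoint hx u
  ext F
  obtain ⟨y, hy, hyF⟩ := exists_lift_of_map_eq _ N hN F.2
  obtain ⟨F', G, H, rfl⟩ := exists_sqZero_decomp y
  obtain rfl : F' = F := tmul_one_injective (by simpa using hyF)
  have key : ∀ (g : k × k →ₗ[k] k) (t : TangentSpace
      (Module.Grassmannian.functor (R := k) (M := V) c) x),
      Module.Grassmannian.map (TrivSqZeroExt.map g) N = tangentPoint t →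
      e t F = Submodule.Quotient.mk (g (1, 0) • G + g (0, 1) • H) := by
    intro g t ht
    refine (he t F _).mp ?_
    rw [← ht]
    have h3 := scalarMap_mem (TrivSqZeroExt.map g) N hy
    have h2 : ∀ a : k, (TrivSqZeroExt.inr a : DualNumber k) = a • DualNumber.eps := by
      intro a
      ext <;> simp
    convert h3 using 1
    simp only [map_add, scalarMap_tmul, map_one, TrivSqZeroExt.map_inr, h2, smul_tmul, tmul_add]
    abel
  rw [LinearMap.add_apply, key _ u hu, key _ v hv, key _ w hw]
  simp

/-- The specializations of `(1 + ε₁ τ₁ + ε₂ τ₂) Λ` along `(ε₁, ε₂) ↦ (g(1, 0) ε, g(0, 1) ε)` are the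
tangent vectors with homomorphism `g(1, 0) τ₁ + g(0, 1) τ₂`. -/
theorem map_deformPoint_eq_tangentPoint
    (hx : (show Module.Grassmannian k (k ⊗[k] V) c from x).toSubmodule = Λ.baseChange k)
    [FiniteDimensional k V] (hc : Module.finrank k (V ⧸ Λ) = c)
    {e : TangentSpace (Module.Grassmannian.functor (R := k) (M := V) c) x → (Λ →ₗ[k] V ⧸ Λ)}
    (he : ∀ v (F : Λ) (G : V), (1 : DualNumber k) ⊗ₜ[k] (F : V) +
      (DualNumber.eps : DualNumber k) ⊗ₜ[k] G ∈ (tangentPoint v).toSubmodule ↔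
        e v F = Submodule.Quotient.mk G) (hinj : Function.Injective e)
    {τ₁ τ₂ : Module.End k V} (g : k × k →ₗ[k] k)
    (v : TangentSpace (Module.Grassmannian.functor (R := k) (M := V) c) x)
    (h : e v = Λ.mkQ ∘ₗ (g (1, 0) • τ₁ + g (0, 1) • τ₂) ∘ₗ Λ.subtype) :
    Module.Grassmannian.map (TrivSqZeroExt.map g) (deformPoint sqZeroPair_inr τ₁ τ₂ Λ hc) =
      tangentPoint v := by
  rw [map_sqZero_deformPoint]
  rw [← tangentOf_apply hx hc he] at h
  rw [hinj h]
  rfl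

/-- The canonical isomorphism `T_{G,Λ} = Hom_k(Λ, V / Λ)`. -/
theorem exists_canonicalGrassIso
    (hx : (show Module.Grassmannian k (k ⊗[k] V) c from x).toSubmodule = Λ.baseChange k)
    [FiniteDimensional k V] (hc : Module.finrank k (V ⧸ Λ) = c) :
    ∃ e : TangentIso (Module.Grassmannian.functor (R := k) (M := V) c) x (Λ →ₗ[k] V ⧸ Λ),
      IsCanonicalGrassIso Λ e := by
  choose e he using fun v => exists_tangentHom (tangentPoint v) (map_tangentPoint hx v)
  have hinj : Function.Injective e := by
    intro v w h
    refine Subtype.ext (eq_of_dual_mem_iff (tangentPoint v) (map_tangentPoint hx v)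
      (tangentPoint w) (map_tangentPoint hx w) fun F G => ?_)
    rw [he, he, h]
  have hsurj : Function.Surjective e := by
    intro τ
    obtain ⟨τ', rfl⟩ := exists_end_lift Λ τ
    exact ⟨_, tangentOf_apply hx hc he τ'⟩
  refine ⟨{ toEquiv := Equiv.ofBijective e ⟨hinj, hsurj⟩, map_smul := ?_, isSum_iff := ?_ }, he⟩
  · intro a v
    change e (a • v) = a • e v
    ext F
    obtain ⟨G, hG⟩ := Submodule.Quotient.mk_surjective Λ (e v F)
    rw [LinearMap.smul_apply, ← hG, ← Submodule.Quotient.mk_smul]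
    refine (he _ F _).mp ?_
    have h1 := scalarMap_mem
      (TrivSqZeroExt.map (a • LinearMap.id) : DualNumber k →ₐ[k] DualNumber k) (tangentPoint v)
      ((he v F G).mpr hG.symm)
    have h2 : (TrivSqZeroExt.map (a • LinearMap.id) : DualNumber k →ₐ[k] DualNumber k)
        DualNumber.eps =
      a • (DualNumber.eps : DualNumber k) := by
      rw [DualNumber.eps, TrivSqZeroExt.map_inr]
      ext <;> simp
    rw [map_add, scalarMap_tmul, scalarMap_tmul, h2, map_one, smul_tmul] at h1
    exact h1
  · intro u v w
    constructor
    · exact hom_eq_add_of_isSum hx he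
    · intro h
      change e w = e u + e v at h
      obtain ⟨τ₁, h₁⟩ := exists_end_lift Λ (e u)
      obtain ⟨τ₂, h₂⟩ := exists_end_lift Λ (e v)
      refine ⟨deformPoint sqZeroPair_inr τ₁ τ₂ Λ hc,
        map_deformPoint_eq_tangentPoint hx hc he hinj _ u ?_,
        map_deformPoint_eq_tangentPoint hx hc he hinj _ v ?_,
        map_deformPoint_eq_tangentPoint hx hc he hinj _ w ?_⟩
      · simp [h₁]
      · simp [h₂]
      · rw [h, ← h₁, ← h₂]
        simp [LinearMap.comp_add, LinearMap.add_comp]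

end Grass

/-- A criterion for the tangent space of a subfunctor `L` of the Grassmannian to be the space of
homomorphisms of degree `0`: the homomorphism of a tangent vector of `L` extends to `P`, and for
homomorphisms that extend to `P` the corresponding deformation over `k[ε₁, ε₂] / (ε₁, ε₂)²` is a
point of `L`. -/
theorem tangentSpaceIsHomZero_of {R M : Type u} [CommRing R] [Algebra k R] [AddCommGroup M]
    [Module k M] [Module R M] [IsScalarTower k R M] (gr : ℕ → Submodule k M) (P : Submodule R M)
    (d : ℕ) [FiniteDimensional k (gr d)] {c : ℕ}
    (hc : Module.finrank k (gr d ⧸ degPart gr P d) = c)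
    (L : Subfunctor (Module.Grassmannian.functor (R := k) (M := gr d) c))
    (hinj : Function.Injective (degComponent gr P d))
    (h_le : ∀ N : Module.Grassmannian (DualNumber k) (DualNumber k ⊗[k] gr d) c,
      N ∈ L.obj (CommAlgCat.of k (DualNumber k)) →
      (Module.Grassmannian.map (TrivSqZeroExt.fstHom k k k) N).toSubmodule =
        (degPart gr P d).baseChange k →
      ∀ τ : degPart gr P d →ₗ[k] gr d ⧸ degPart gr P d,
        (∀ (F : degPart gr P d) (G : gr d), (1 : DualNumber k) ⊗ₜ (F : gr d) +
          (DualNumber.eps : DualNumber k) ⊗ₜ G ∈ N.toSubmodule ↔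
            τ F = Submodule.Quotient.mk G) →
        τ ∈ LinearMap.range (degComponent gr P d))
    (h_ge : ∀ τ₁ τ₂ : Module.End k (gr d),
      (degPart gr P d).mkQ ∘ₗ τ₁ ∘ₗ (degPart gr P d).subtype ∈
        LinearMap.range (degComponent gr P d) →
      (degPart gr P d).mkQ ∘ₗ τ₂ ∘ₗ (degPart gr P d).subtype ∈
        LinearMap.range (degComponent gr P d) →
      deformPoint sqZeroPair_inr τ₁ τ₂ (degPart gr P d) hc ∈
        L.obj (CommAlgCat.of k (TrivSqZeroExt k (k × k)))) :
    TangentSpaceIsHomZero gr P d L := by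
  set Λ := degPart gr P d
  have hx0 : deformPoint sqZeroPair_zero 0 0 Λ hc ∈ L.obj (CommAlgCat.of k k) := by
    have h1 := L.map (origin k (k × k)) (h_ge 0 0 (by simp) (by simp))
    have h2 := map_deformPoint (TrivSqZeroExt.fstHom k k (k × k)) sqZeroPair_inr sqZeroPair_zero
      (TrivSqZeroExt.fst_inr k (1, 0)) (TrivSqZeroExt.fst_inr k (0, 1)) 0 0 Λ hc
    rw [← h2]
    exact h1
  let x : L.toFunctor.obj (CommAlgCat.of k k) := ⟨_, hx0⟩
  have hx : (show Module.Grassmannian k (k ⊗[k] gr d) c from L.ι.app _ x).toSubmodule =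
    Λ.baseChange k := deformPoint_zero_toSubmodule 0 0 Λ hc
  obtain ⟨eG, heG⟩ := exists_canonicalGrassIso hx hc
  choose f hf using fun v : TangentSpace L.toFunctor x =>
    h_le (tangentPoint (TangentSpace.differential L.ι x v)) v.1.2
      (map_tangentPoint hx _) _ (heG (TangentSpace.differential L.ι x v))
  have hfinj : Function.Injective f := by
    intro v w h
    have h1 := (hf v).symm.trans ((congrArg _ h).trans (hf w))
    have h2 : v.1.1 = w.1.1 := congrArg tangentPoint (eG.toEquiv.injective h1)
    exact Subtype.ext (Subtype.ext h2)
  have key : ∀ (τ₁ τ₂ : Module.End k (gr d)) (g : k × k →ₗ[k] k) (v : TangentSpace L.toFunctor x),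
      degComponent gr P d (f v) = Λ.mkQ ∘ₗ (g (1, 0) • τ₁ + g (0, 1) • τ₂) ∘ₗ Λ.subtype →
      Module.Grassmannian.map (TrivSqZeroExt.map g) (deformPoint sqZeroPair_inr τ₁ τ₂ Λ hc) =
        v.1.1 := by
    intro τ₁ τ₂ g v h
    rw [hf] at h
    exact map_deformPoint_eq_tangentPoint hx hc heG eG.toEquiv.injective g _ h
  have hfsurj : Function.Surjective f := by
    intro ψ
    obtain ⟨τ, hτ⟩ := exists_end_lift Λ (degComponent gr P d ψ)
    let z : L.toFunctor.obj (CommAlgCat.of k (TrivSqZeroExt k (k × k))) :=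
      ⟨_, h_ge τ 0 (hτ ▸ ⟨ψ, rfl⟩) (by simp)⟩
    have h1 : Module.Grassmannian.map (TrivSqZeroExt.map (LinearMap.fst k k k))
        (deformPoint sqZeroPair_inr τ 0 Λ hc) = tangentPoint (tangentOf hx hc τ) := by
      rw [map_sqZero_deformPoint]
      exact deformPoint_congr sqZeroPair_eps sqZeroPair_eps _ _ _ _ Λ hc fun F => by simp
    let v : TangentSpace L.toFunctor x := ⟨L.toFunctor.map (sqZeroMap (LinearMap.fst k k k)) z,
      Subtype.ext ((congrArg (Module.Grassmannian.map (TrivSqZeroExt.fstHom k k k)) h1).trans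
        (tangentOf hx hc τ).2)⟩
    refine ⟨v, hinj ?_⟩
    have h2 : TangentSpace.differential L.ι x v = tangentOf hx hc τ := Subtype.ext h1
    rw [hf, h2, ← hτ]
    exact tangentOf_apply hx hc heG τ
  refine ⟨x, eG,
    { toEquiv := Equiv.ofBijective f ⟨hfinj, hfsurj⟩, map_smul := ?_, isSum_iff := ?_ },
    hx, heG, hinj, fun v => (hf v).symm⟩
  · intro a v
    apply hinj
    change degComponent gr P d (f (a • v)) = degComponent gr P d (a • f v)
    rw [hf, map_smul, hf]
    exact eG.map_smul a (TangentSpace.differential L.ι x v)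
  · intro u v w
    constructor
    · rintro ⟨z, hu, hv, hw⟩
      apply hinj
      change degComponent gr P d (f w) = degComponent gr P d (f u + f v)
      rw [map_add, hf, hf, hf]
      exact (eG.isSum_iff _ _ _).mp ⟨z.1, congrArg Subtype.val hu, congrArg Subtype.val hv,
        congrArg Subtype.val hw⟩
    · intro h
      change f w = f u + f v at h
      obtain ⟨τ₁, h₁⟩ := exists_end_lift Λ (degComponent gr P d (f u))
      obtain ⟨τ₂, h₂⟩ := exists_end_lift Λ (degComponent gr P d (f v))
      refine ⟨⟨_, h_ge τ₁ τ₂ (h₁ ▸ ⟨_, rfl⟩) (h₂ ▸ ⟨_, rfl⟩)⟩,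
        Subtype.ext (key τ₁ τ₂ _ u ?_), Subtype.ext (key τ₁ τ₂ _ v ?_),
        Subtype.ext (key τ₁ τ₂ _ w ?_)⟩
      · simp [h₁]
      · simp [h₂]
      · rw [h, map_add, ← h₁, ← h₂]
        simp [LinearMap.comp_add, LinearMap.add_comp]

end Tangent

/-! ### Apolarity -/

section Separate

variable {k V W : Type*} [Field k] [AddCommGroup V] [Module k V] [AddCommGroup W] [Module k W]

theorem flip_bijective_of_bijective [FiniteDimensional k W] {p : V →ₗ[k] W →ₗ[k] k}
    (hp : Function.Bijective p) : Function.Bijective p.flip :=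
  LinearMap.flip_bijective_iff₂.mpr hp

theorem exists_separating [FiniteDimensional k W] {p : V →ₗ[k] W →ₗ[k] k}
    (hp : Function.Bijective p) (A : Submodule k V) {v : V} (hv : v ∉ A) :
    ∃ w, (∀ a ∈ A, p a w = 0) ∧ p v w ≠ 0 := by
  obtain ⟨f, hfv, hf⟩ := Submodule.exists_le_ker_of_notMem hv
  obtain ⟨w, rfl⟩ := (flip_bijective_of_bijective hp).2 f
  exact ⟨w, fun a ha => hf ha, hfv⟩

end Separate

section Apolarity

variable {n : ℕ} {k : Type u} [Field k]

variable (n k) in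
/-- The apolarity pairing `(u, F) ↦ (u • F)(0)` on all of `R × S`. -/
def pairRS : PolyR n k →ₗ[k] PolyS n k →ₗ[k] k :=
  LinearMap.mk₂ k (fun u F => coeff 0 (toPoly n k (u • F)))
    (fun u v F => by simp [add_smul])
    (fun c u F => by simp)
    (fun u F G => by simp)
    (fun c u F => by simp [smul_comm _ c])

theorem apolar_apply {d : ℕ} (u : gradeR n k d) (F : gradeS n k d) :
    apolar n k d u F = pairRS n k u F := rfl

theorem pairRS_mul (u v : PolyR n k) (F : PolyS n k) :
    pairRS n k (u * v) F = pairRS n k u (v • F) := by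
  change coeff 0 (toPoly n k ((u * v) • F)) = _
  rw [mul_smul]
  rfl

variable (n k) in
/-- The projection `S → S_i`. -/
def compS (i : ℕ) : PolyS n k →ₗ[k] PolyS n k :=
  (toPoly n k).symm.toLinearMap ∘ₗ homogeneousComponent i ∘ₗ (toPoly n k).toLinearMap

theorem compS_mem (i : ℕ) (F : PolyS n k) : compS n k i F ∈ gradeS n k i :=
  homogeneousComponent_mem i (toPoly n k F)

theorem exists_sum_compS (F : PolyS n k) :
    ∃ m, F = ∑ i ∈ Finset.range m, compS n k i F := by
  refine ⟨(toPoly n k F).totalDegree + 1, ?_⟩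
  exact (sum_homogeneousComponent (toPoly n k F)).symm

theorem compS_of_mem {i j : ℕ} {F : PolyS n k} (hF : F ∈ gradeS n k j) :
    compS n k i F = if i = j then F else 0 := by
  have h := homogeneousComponent_of_mem (m := i) (n := j) (p := toPoly n k F) hF
  change homogeneousComponent i (toPoly n k F) = _
  rw [h]
  split_ifs <;> simp_all <;> rfl

variable {I : Ideal (PolyR n k)}

theorem mem_inverseSystem {F : PolyS n k} :
    F ∈ inverseSystem I ↔ ∀ u ∈ I, u • F = 0 := by
  simp [inverseSystem, Submodule.mem_torsionBySet_iff]

variable [CharZero k]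

/-- Differentiating a form more often than its degree gives zero, and differentiating it less often
leaves no constant term. -/
theorem pairRS_eq_zero {i j : ℕ} (hij : i ≠ j) {u : PolyR n k} (hu : u ∈ gradeR n k i)
    {F : PolyS n k} (hF : F ∈ gradeS n k j) : pairRS n k u F = 0 := by
  rw [u.as_sum, map_sum, LinearMap.sum_apply]
  refine Finset.sum_eq_zero fun s hs => ?_
  have hdeg : s.degree = i := by
    have := hu (mem_support_iff.mp hs)
    rwa [Finsupp.degree_eq_weight_one]
  obtain ⟨c, hc, h⟩ := exists_coeff_monomial_smul (k := k) s 0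
  have h2 : (monomial s (coeff s u) : PolyR n k) = coeff s u • monomial s 1 := by
    simp [smul_monomial]
  rw [h2, map_smul, LinearMap.smul_apply]
  change coeff s u • coeff 0 (toPoly n k ((monomial s 1 : PolyR n k) • F)) = 0
  rw [h]
  by_cases h3 : coeff (0 + s) (toPoly n k F) = 0
  · rw [h3]
    simp
  · have h4 := hF h3
    rw [zero_add] at h4
    have h5 : s.degree = j := by rwa [Finsupp.degree_eq_weight_one]
    exact absurd (hdeg.symm.trans h5) hij

theorem pairRS_compS {i : ℕ} {u : PolyR n k} (hu : u ∈ gradeR n k i) (F : PolyS n k) :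
    pairRS n k u (compS n k i F) = pairRS n k u F := by
  obtain ⟨m, hm⟩ := exists_sum_compS F
  conv_rhs => rw [hm, map_sum]
  have h1 : ∀ j, pairRS n k u (compS n k j F) =
      if j = i then pairRS n k u (compS n k i F) else 0 := by
    intro j
    split_ifs with h
    · rw [h]
    · exact pairRS_eq_zero (Ne.symm h) hu (compS_mem j F)
  rw [Finset.sum_congr rfl fun j _ => h1 j, Finset.sum_ite_eq']
  split_ifs with h
  · rfl
  · have h2 : compS n k i F = 0 := by
      rw [hm, map_sum]
      refine Finset.sum_eq_zero fun j hj => ?_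
      rw [compS_of_mem (compS_mem j F), if_neg]
      rintro rfl
      exact h hj
    rw [h2, map_zero]

theorem pairRS_component {i : ℕ} (u : PolyR n k) {F : PolyS n k} (hF : F ∈ gradeS n k i) :
    pairRS n k (homogeneousComponent i u) F = pairRS n k u F := by
  conv_rhs => rw [← sum_homogeneousComponent u, map_sum, LinearMap.sum_apply]
  have h1 : ∀ j, pairRS n k (homogeneousComponent j u) F =
      if j = i then pairRS n k (homogeneousComponent i u) F else 0 := by
    intro j
    split_ifs with h
    · rw [h]
    · exact pairRS_eq_zero h (homogeneousComponent_mem j u) hF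
  rw [Finset.sum_congr rfl fun j _ => h1 j, Finset.sum_ite_eq']
  split_ifs with h
  · rfl
  · rw [homogeneousComponent_eq_zero i u (by simpa using h), map_zero, LinearMap.zero_apply]

theorem eq_zero_of_pairRS {i : ℕ} {F : PolyS n k} (hF : F ∈ gradeS n k i)
    (h : ∀ u ∈ gradeR n k i, pairRS n k u F = 0) : F = 0 := by
  have h1 : (apolar n k i).flip ⟨F, hF⟩ = 0 := LinearMap.ext fun u => h u u.2
  have h2 := (flip_bijective_of_bijective (apolar_bijective n k i)).1 (h1.trans (map_zero _).symm)
  exact congrArg Subtype.val h2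

theorem eq_zero_of_pairRS_left {F : PolyS n k} (h : ∀ u, pairRS n k u F = 0) : F = 0 := by
  obtain ⟨m, hm⟩ := exists_sum_compS F
  rw [hm]
  refine Finset.sum_eq_zero fun i _ => eq_zero_of_pairRS (compS_mem i F) fun u hu => ?_
  rw [pairRS_compS hu, h]

/-- The inverse system is the orthogonal of `I` under the apolarity pairing. -/
theorem mem_inverseSystem_iff {F : PolyS n k} :
    F ∈ inverseSystem I ↔ ∀ u ∈ I, pairRS n k u F = 0 := by
  rw [mem_inverseSystem]
  constructor
  · intro h u hu
    change coeff 0 (toPoly n k (u • F)) = 0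
    simp [h u hu]
  · intro h u hu
    refine eq_zero_of_pairRS_left fun v => ?_
    rw [← pairRS_mul]
    exact h _ (I.mul_mem_left v hu)

variable (hI : I.IsHomogeneous (homogeneousSubmodule (Fin n) k))
include hI

theorem mem_inverseSystem_iff_of_mem {i : ℕ} {F : PolyS n k} (hF : F ∈ gradeS n k i) :
    F ∈ inverseSystem I ↔ ∀ u ∈ I, u ∈ gradeR n k i → pairRS n k u F = 0 := by
  rw [mem_inverseSystem_iff]
  refine ⟨fun h u hu _ => h u hu, fun h u hu => ?_⟩
  rw [← pairRS_component u hF]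
  exact h _ (homogeneousComponent_mem_of_mem hI hu i) (homogeneousComponent_mem i u)

theorem compS_mem_inverseSystem (i : ℕ) {F : PolyS n k} (hF : F ∈ inverseSystem I) :
    compS n k i F ∈ inverseSystem I := by
  rw [mem_inverseSystem_iff_of_mem hI (compS_mem i F)]
  intro u hu hui
  rw [pairRS_compS hui]
  exact mem_inverseSystem_iff.mp hF u hu

/-- `I` is the orthogonal of its inverse system, degree by degree. -/
theorem mem_of_pairRS_eq_zero {i : ℕ} {u : PolyR n k} (hu : u ∈ gradeR n k i)
    (h : ∀ F ∈ inverseSystem I, F ∈ gradeS n k i → pairRS n k u F = 0) : u ∈ I := by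
  by_contra hc
  obtain ⟨F, hF, h0⟩ := exists_separating (apolar_bijective n k i)
    (degPart (gradeR n k) I i) (v := ⟨u, hu⟩) hc
  refine h0 (h F ?_ F.2)
  rw [mem_inverseSystem_iff_of_mem hI F.2]
  exact fun v hv hvi => hF ⟨v, hvi⟩ hv

/-- `I` is the orthogonal of its inverse system. -/
theorem mem_of_forall_pairRS_eq_zero {u : PolyR n k}
    (h : ∀ F ∈ inverseSystem I, pairRS n k u F = 0) : u ∈ I := by
  rw [mem_iff_homogeneousComponent_mem hI]
  intro i
  refine mem_of_pairRS_eq_zero hI (homogeneousComponent_mem i u) fun F hF hFi => ?_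
  rw [pairRS_component u hFi]
  exact h F hF

/-- The graded pieces of `I⁻¹` and `R / I` are dual to each other. -/
theorem finrank_degPart_inverseSystem (i : ℕ) :
    Module.finrank k (degPart (gradeS n k) (inverseSystem I) i) = hilbertFn I i := by
  let e := LinearEquiv.ofBijective _ (flip_bijective_of_bijective (apolar_bijective n k i))
  have h1 : degPart (gradeS n k) (inverseSystem I) i =
      (degPart (gradeR n k) I i).dualAnnihilator.comap e.toLinearMap := by
    ext F
    rw [Submodule.mem_comap, Submodule.mem_dualAnnihilator]
    change (F : PolyS n k) ∈ inverseSystem I ↔ _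
    rw [mem_inverseSystem_iff_of_mem hI F.2]
    exact ⟨fun h u hu => h u hu u.2, fun h u hu hui => h ⟨u, hui⟩ hu⟩
  have h2 : Module.finrank k (degPart (gradeS n k) (inverseSystem I) i) =
      Module.finrank k (degPart (gradeR n k) I i).dualAnnihilator := by
    rw [h1]
    rw [Submodule.comap_equiv_eq_map_symm]
    exact LinearEquiv.finrank_map_eq _ _
  have h3 := Subspace.finrank_add_finrank_dualAnnihilator_eq (degPart (gradeR n k) I i)
  have h4 := (degPart (gradeR n k) I i).finrank_quotient_add_finrank
  have h5 := (degQuotEquiv (gradeR n k) I i).finrank_eq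
  unfold hilbertFn
  omega

end Apolarity

/-! ### Level algebras -/

section Level

variable {n : ℕ} {k : Type u} [Field k] {I : Ideal (PolyR n k)} {t d : ℕ}

theorem IsArtinLevel.mem_of_lt (hI : IsArtinLevel I t d) {i : ℕ} (hi : d < i) {u : PolyR n k}
    (hu : u ∈ gradeR n k i) : u ∈ I := by
  have h1 : I.mkQ u ∈ quotGrade (gradeR n k) I i := ⟨u, hu, rfl⟩
  rw [hI.eq_bot i hi] at h1
  exact (Submodule.Quotient.mk_eq_zero I).mp h1

theorem IsArtinLevel.one_notMem (hI : IsArtinLevel I t d) : (1 : PolyR n k) ∉ I := by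
  intro h
  apply hI.top_ne_bot
  rw [eq_bot_iff]
  rintro _ ⟨u, -, rfl⟩
  refine (Submodule.Quotient.mk_eq_zero I).mpr ?_
  rw [(Ideal.eq_top_iff_one I).mpr h]
  trivial

theorem IsArtinLevel.eq_zero_of_mem_gradeR_zero (hI : IsArtinLevel I t d) {u : PolyR n k}
    (hu : u ∈ I) (hu0 : u ∈ gradeR n k 0) : u = 0 := by
  have h1 : u = C (coeff 0 u) := by
    rw [← homogeneousComponent_zero, homogeneousComponent_of_mem hu0, if_pos rfl]
  by_contra hc
  have h2 : coeff 0 u ≠ 0 := fun h => hc (by rw [h1, h, C_0])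
  apply hI.one_notMem
  have := I.mul_mem_left (C (coeff 0 u)⁻¹) hu
  rwa [h1, coeff_C, if_pos rfl, ← C_mul, inv_mul_cancel₀ h2, C_1] at this

/-- In a level algebra of socle degree `d`, an element of degree `i ≤ d` that is annihilated by all
forms of degree `d - i` vanishes. -/
theorem IsArtinLevel.mem_of_forall_mul_mem (hI : IsArtinLevel I t d) {i e : ℕ} (hie : i + e = d)
    {u : PolyR n k} (hu : u ∈ gradeR n k i) (h : ∀ v ∈ gradeR n k e, v * u ∈ I) : u ∈ I := by
  induction e generalizing i u with
  | zero => simpa using h 1 (isHomogeneous_one _ _)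
  | succ e ih =>
    have h1 : ∀ j, X j * u ∈ I := by
      intro j
      refine ih (i := i + 1) (by omega) ?_ fun v hv => ?_
      · rw [add_comm]
        exact (isHomogeneous_X k j).mul hu
      · rw [← mul_assoc]
        exact h _ (hv.mul (isHomogeneous_X k j))
    -- `u` lies in the socle, which lives in degree `d ≠ i`
    obtain ⟨w, hw, hwu⟩ := (hI.socle (Ideal.Quotient.mk I u)).mp fun j => by
      rw [← map_mul, Ideal.Quotient.eq_zero_iff_mem, mul_comm]
      exact h1 j
    have h2 : u - w ∈ I := by
      rw [← Ideal.Quotient.eq]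
      exact hwu.symm
    have h3 := homogeneousComponent_mem_of_mem hI.homogeneous h2 i
    rwa [map_sub, homogeneousComponent_of_mem hu, homogeneousComponent_of_mem hw, if_pos rfl,
      if_neg (by omega), sub_zero] at h3

variable [CharZero k]

/-- The inverse system of a level algebra is generated in degree `d`. -/
theorem IsArtinLevel.prodSpan_eq (hI : IsArtinLevel I t d) {i : ℕ} (hi : i ≤ d) :
    prodSpan (contract n k hi) (degPart (gradeS n k) (inverseSystem I) d) =
      degPart (gradeS n k) (inverseSystem I) i := by
  apply le_antisymm
  · refine Submodule.span_le.mpr ?_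
    rintro _ ⟨u, F, hF, rfl⟩
    exact (inverseSystem I).smul_mem _ hF
  · intro F hF
    by_contra hc
    -- a form `u` orthogonal to all products lies in `I`, as `R_{d-i} u` is orthogonal to `Λ`
    obtain ⟨u, hu, h0⟩ := exists_separating
      (flip_bijective_of_bijective (apolar_bijective n k i)) _ hc
    refine h0 (mem_inverseSystem_iff.mp hF u ?_)
    refine hI.mem_of_forall_mul_mem (i := i) (e := d - i) (by omega) u.2 fun v hv => ?_
    refine mem_of_pairRS_eq_zero hI.homogeneous (i := d) ?_ fun G hG hGd => ?_
    · have := hv.mul u.2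
      rwa [Nat.sub_add_cancel hi] at this
    · rw [mul_comm, pairRS_mul]
      exact hu _ (mem_prodSpan (contract n k hi) ⟨v, hv⟩ (F := ⟨G, hGd⟩) hG)

theorem IsArtinLevel.eq_zero_of_lt (hI : IsArtinLevel I t d) {i : ℕ} (hi : d < i) {F : PolyS n k}
    (hF : F ∈ inverseSystem I) (hFi : F ∈ gradeS n k i) : F = 0 :=
  eq_zero_of_pairRS hFi fun u hu => mem_inverseSystem_iff.mp hF u (hI.mem_of_lt hi hu)

end Level

/-! ### Extending homomorphisms from degree `d` -/

section Extend

variable {n : ℕ} {k : Type u} [Field k] {I : Ideal (PolyR n k)} {t d : ℕ}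

/-- The condition on a linear map `σ : S_d → S_d` under which its restriction to `Λ = (I⁻¹)_d`
extends to a homomorphism `I⁻¹ → S / I⁻¹`, and its transpose extends to a homomorphism
`I → R / I`. It says that for `u ∈ I` the functional `v F ↦ ⟨u, v σ(F)⟩` on `I⁻¹ = R Λ` is well
defined; being a functional on `I⁻¹`, it is then the pairing with an element `a` of `R`. -/
def IsExtendable (I : Ideal (PolyR n k)) (d : ℕ) (σ : Module.End k (gradeS n k d)) : Prop :=
  ∀ i, ∀ u ∈ I, u ∈ gradeR n k i → ∃ a ∈ gradeR n k i, ∀ j, i + j = d → ∀ v ∈ gradeR n k j,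
    ∀ F : gradeS n k d, (F : PolyS n k) ∈ inverseSystem I →
      pairRS n k u (v • (σ F : PolyS n k)) = pairRS n k a (v • (F : PolyS n k))

/-- The inverse system of a level algebra is generated by `Λ` as an `R`-module. -/
theorem IsArtinLevel.span_eq_top [CharZero k] (hI : IsArtinLevel I t d) :
    Submodule.span (PolyR n k) (Set.range (degIncl (gradeS n k) (inverseSystem I) d)) = ⊤ := by
  have h : inverseSystem I ≤ Submodule.span (PolyR n k)
      ((↑) '' (degPart (gradeS n k) (inverseSystem I) d : Set (gradeS n k d))) := by
    intro F hF
    obtain ⟨m, hm⟩ := exists_sum_compS F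
    rw [hm]
    refine Submodule.sum_mem _ fun i _ => ?_
    have hF' := compS_mem_inverseSystem hI.homogeneous i hF
    by_cases hi : i ≤ d
    · have h1 : (⟨compS n k i F, compS_mem i F⟩ : gradeS n k i) ∈
          prodSpan (contract n k hi) (degPart (gradeS n k) (inverseSystem I) d) := by
        rw [hI.prodSpan_eq hi]
        exact hF'
      have h2 : prodSpan (contract n k hi) (degPart (gradeS n k) (inverseSystem I) d) ≤
          ((Submodule.span (PolyR n k) ((↑) ''
            (degPart (gradeS n k) (inverseSystem I) d : Set (gradeS n k d)))).restrictScalars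
              k).comap (gradeS n k i).subtype := by
        refine Submodule.span_le.mpr ?_
        rintro _ ⟨u, G, hG, rfl⟩
        have h3 : (G : PolyS n k) ∈ Submodule.span (PolyR n k)
            ((↑) '' (degPart (gradeS n k) (inverseSystem I) d : Set (gradeS n k d))) :=
          Submodule.subset_span ⟨G, hG, rfl⟩
        exact Submodule.smul_mem _ (u : PolyR n k) h3
      exact h2 h1
    · rw [hI.eq_zero_of_lt (by omega) hF' (compS_mem i F)]
      exact zero_mem _
  apply Submodule.map_injective_of_injective (inverseSystem I).injective_subtype
  rw [Submodule.map_subtype_top, Submodule.map_span]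
  apply le_antisymm
  · rw [Submodule.span_le]
    rintro _ ⟨_, ⟨F, rfl⟩, rfl⟩
    exact F.2
  · refine h.trans (Submodule.span_mono ?_)
    rintro _ ⟨F, hF, rfl⟩
    exact ⟨_, ⟨⟨F, hF⟩, rfl⟩, rfl⟩

theorem IsArtinLevel.degComponent_inverseSystem_injective [CharZero k] (hI : IsArtinLevel I t d) :
    Function.Injective (degComponent (gradeS n k) (inverseSystem I) d) := by
  intro ψ ψ' h
  apply Subtype.ext
  refine LinearMap.ext_on_range hI.span_eq_top fun F => ?_
  rw [← degQuotIncl_degComponent, ← degQuotIncl_degComponent, h]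

theorem IsArtinLevel.degComponent_injective (hI : IsArtinLevel I t d) :
    Function.Injective (degComponent (gradeR n k) I d) := by
  rw [injective_iff_map_eq_zero]
  intro ψ hψ
  have hd : ∀ u (hu : u ∈ I), u ∈ gradeR n k d → ψ.1 ⟨u, hu⟩ = 0 := by
    intro u hu hud
    have := degQuotIncl_degComponent (gradeR n k) I d ψ ⟨⟨u, hud⟩, hu⟩
    rw [hψ] at this
    exact this.symm.trans (map_zero _)
  have hi : ∀ i u (hu : u ∈ I), u ∈ gradeR n k i → ψ.1 ⟨u, hu⟩ = 0 := by
    intro i u hu hui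
    obtain ⟨a, ha, hau⟩ := ψ.2 i ⟨u, hu⟩ hui
    rw [← hau]
    refine (Submodule.Quotient.mk_eq_zero I).mpr ?_
    by_cases hid : i ≤ d
    · refine hI.mem_of_forall_mul_mem (e := d - i) (by omega) ha fun v hv => ?_
      rw [← smul_eq_mul, ← Submodule.Quotient.mk_eq_zero I, Submodule.Quotient.mk_smul]
      have h1 : Submodule.Quotient.mk a = ψ.1 ⟨u, hu⟩ := hau
      rw [h1, ← map_smul]
      refine hd _ (I.mul_mem_left v hu) ?_
      have := hv.mul hui
      rwa [Nat.sub_add_cancel hid] at this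
    · exact hI.mem_of_lt (by omega) ha
  apply Subtype.ext
  ext ⟨u, hu⟩
  have hu' : (⟨u, hu⟩ : I) = ∑ i ∈ Finset.range (u.totalDegree + 1),
      ⟨homogeneousComponent i u, homogeneousComponent_mem_of_mem hI.homogeneous hu i⟩ := by
    apply Subtype.ext
    rw [AddSubmonoidClass.coe_finsetSum]
    exact (sum_homogeneousComponent u).symm
  rw [hu', map_sum]
  exact Finset.sum_eq_zero fun i _ => hi i _ _ (homogeneousComponent_mem i u)

variable [CharZero k]

/-- The condition for homogeneous elements implies the condition for all elements. -/
theorem IsExtendable.exists_pairRS_eq {σ : Module.End k (gradeS n k d)} (hσ : IsExtendable I d σ)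
    (hI : I.IsHomogeneous (homogeneousSubmodule (Fin n) k)) {u : PolyR n k} (hu : u ∈ I) :
    ∃ a, (∀ i, u ∈ gradeR n k i → a ∈ gradeR n k i) ∧ ∀ (v : PolyR n k) (F : gradeS n k d),
      (F : PolyS n k) ∈ inverseSystem I →
        pairRS n k u (v • (σ F : PolyS n k)) = pairRS n k a (v • (F : PolyS n k)) := by
  classical
  choose a ha h using fun i => hσ i (homogeneousComponent i u)
    (homogeneousComponent_mem_of_mem hI hu i) (homogeneousComponent_mem i u)
  refine ⟨∑ i ∈ Finset.range (u.totalDegree + 1),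
    if homogeneousComponent i u = 0 then 0 else a i, ?_, ?_⟩
  · intro i hui
    refine Submodule.sum_mem _ fun j _ => ?_
    split_ifs with h0
    · exact zero_mem _
    · rw [homogeneousComponent_of_mem hui] at h0
      have hij : j = i := by
        by_contra hc
        exact h0 (if_neg hc)
      exact hij ▸ ha j
  · intro v F hF
    conv_lhs => rw [← sum_homogeneousComponent u]
    rw [map_sum, map_sum, LinearMap.sum_apply, LinearMap.sum_apply]
    refine Finset.sum_congr rfl fun i _ => ?_
    split_ifs with h0
    · rw [h0]
      simp
    · conv_lhs => rw [← sum_homogeneousComponent v]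
      conv_rhs => rw [← sum_homogeneousComponent v]
      rw [Finset.sum_smul, Finset.sum_smul, map_sum, map_sum]
      refine Finset.sum_congr rfl fun j _ => ?_
      by_cases hij : i + j = d
      · exact h i j hij _ (homogeneousComponent_mem j v) F hF
      · rw [← pairRS_mul, ← pairRS_mul,
          pairRS_eq_zero hij ((homogeneousComponent_mem i u).mul (homogeneousComponent_mem j v))
            (σ F).2,
          pairRS_eq_zero hij ((ha i).mul (homogeneousComponent_mem j v)) F.2]

/-- Extension of the degree `d` component to the inverse system. -/
theorem IsExtendable.mem_range_inverseSystem {σ : Module.End k (gradeS n k d)}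
    (hσ : IsExtendable I d σ) (hI : IsArtinLevel I t d) :
    (degPart (gradeS n k) (inverseSystem I) d).mkQ ∘ₗ σ ∘ₗ
        (degPart (gradeS n k) (inverseSystem I) d).subtype ∈
      LinearMap.range (degComponent (gradeS n k) (inverseSystem I) d) := by
  set Q := inverseSystem I
  -- the presentation `R ⊗ Λ → I⁻¹`, and the map `R ⊗ Λ → S` defined by `σ`
  let p : PolyR n k ⊗[k] degPart (gradeS n k) Q d →ₗ[PolyR n k] Q :=
    (degIncl (gradeS n k) Q d).liftBaseChange (PolyR n k)
  let q : PolyR n k ⊗[k] degPart (gradeS n k) Q d →ₗ[PolyR n k] PolyS n k :=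
    ((gradeS n k d).subtype ∘ₗ σ ∘ₗ (degPart (gradeS n k) Q d).subtype).liftBaseChange (PolyR n k)
  have hp1 : ∀ v F, p (v ⊗ₜ F) = v • degIncl (gradeS n k) Q d F := fun v F => by simp [p]
  have hq1 : ∀ v F, q (v ⊗ₜ F) = v • (σ F : PolyS n k) := fun v F => by simp [q]
  have hp : Function.Surjective p := by
    rw [← LinearMap.range_eq_top, eq_top_iff, ← hI.span_eq_top, Submodule.span_le]
    rintro _ ⟨F, rfl⟩
    exact ⟨1 ⊗ₜ F, by rw [hp1, one_smul]⟩
  have hker : LinearMap.ker p ≤ LinearMap.ker (Q.mkQ ∘ₗ q) := by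
    intro z hz
    rw [LinearMap.mem_ker, LinearMap.comp_apply, Submodule.mkQ_apply, Submodule.Quotient.mk_eq_zero]
    refine mem_inverseSystem_iff.mpr fun u hu => ?_
    obtain ⟨a, -, ha⟩ := hσ.exists_pairRS_eq hI.homogeneous hu
    have h1 : ∀ z, pairRS n k u (q z) = pairRS n k a (p z : PolyS n k) := by
      intro z
      induction z with
      | zero => simp
      | add x y hx hy => simp only [map_add, hx, hy, Submodule.coe_add]
      | tmul v F =>
        rw [hp1, hq1]
        exact ha v F F.2
    rw [h1, LinearMap.mem_ker.mp hz]
    simp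
  let ψ : Q →ₗ[PolyR n k] PolyS n k ⧸ Q :=
    (LinearMap.ker p).liftQ (Q.mkQ ∘ₗ q) hker ∘ₗ
      (p.quotKerEquivOfSurjective hp).symm.toLinearMap
  have hψ : ∀ z, ψ (p z) = Q.mkQ (q z) := by
    intro z
    have : (p.quotKerEquivOfSurjective hp).symm (p z) = Submodule.Quotient.mk z := by
      rw [LinearEquiv.symm_apply_eq]
      rfl
    simp [ψ, this]
  have hψd : ∀ (v : PolyR n k) F,
      ψ (v • degIncl (gradeS n k) Q d F) = Q.mkQ (v • (σ F : PolyS n k)) := by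
    intro v F
    rw [← hp1, hψ, hq1]
  have hgr : ψ ∈ homZero (R := PolyR n k) (subGrade (gradeS n k) Q) (quotGrade (gradeS n k) Q) := by
    rintro i ⟨F, hF⟩ hFi
    change F ∈ gradeS n k i at hFi
    by_cases hi : i ≤ d
    · have h1 : (⟨F, hFi⟩ : gradeS n k i) ∈
          prodSpan (contract n k hi) (degPart (gradeS n k) Q d) := by
        rw [hI.prodSpan_eq hi]
        exact hF
      have h2 : prodSpan (contract n k hi) (degPart (gradeS n k) Q d) ≤
          ((quotGrade (gradeS n k) Q i).comap
            ((ψ.restrictScalars k) ∘ₗ degIncl (gradeS n k) Q i)).map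
              (degPart (gradeS n k) Q i).subtype := by
        refine Submodule.span_le.mpr ?_
        rintro _ ⟨u, G, hG, rfl⟩
        refine ⟨⟨contract n k hi u G, Q.smul_mem _ hG⟩, ?_, rfl⟩
        refine ⟨(u : PolyR n k) • (σ G : PolyS n k), smul_mem_gradeS (by omega) u.2 (σ G).2, ?_⟩
        exact (hψd u ⟨G, hG⟩).symm
      obtain ⟨G, hG, hGF⟩ := h2 h1
      have h3 : degIncl (gradeS n k) Q i G = ⟨F, hF⟩ := by
        have h4 : ((G : gradeS n k i) : PolyS n k) = F := congrArg Subtype.val hGF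
        exact Subtype.ext h4
      rw [← h3]
      exact hG
    · have h1 : (⟨F, hF⟩ : Q) = 0 := Subtype.ext (hI.eq_zero_of_lt (by omega) hF hFi)
      rw [h1, map_zero]
      exact zero_mem _
  refine ⟨⟨ψ, hgr⟩, ?_⟩
  ext F
  apply degQuotIncl_injective
  rw [degQuotIncl_degComponent]
  have := hψd 1 F
  rw [one_smul, one_smul] at this
  exact this

/-- Extension of the transpose of the degree `d` component to the ideal. -/
theorem IsExtendable.mem_range_ideal {σ : Module.End k (gradeS n k d)}
    (hσ : IsExtendable I d σ) (hI : IsArtinLevel I t d) {τ : Module.End k (gradeR n k d)}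
    (hτ : ∀ u F, apolar n k d (τ u) F = -apolar n k d u (σ F)) :
    (degPart (gradeR n k) I d).mkQ ∘ₗ τ ∘ₗ (degPart (gradeR n k) I d).subtype ∈
      LinearMap.range (degComponent (gradeR n k) I d) := by
  choose a hai ha using fun u : I => hσ.exists_pairRS_eq hI.homogeneous u.2
  -- `a u` is determined modulo `I`, as the elements `v F` span `I⁻¹`; so its class is linear in `u`
  have huniq : ∀ b : PolyR n k, (∀ (v : PolyR n k) (F : gradeS n k d),
      (F : PolyS n k) ∈ inverseSystem I → pairRS n k b (v • (F : PolyS n k)) = 0) → b ∈ I := by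
    intro b hb
    refine mem_of_forall_pairRS_eq_zero hI.homogeneous fun G hG => ?_
    have h1 : (⟨G, hG⟩ : inverseSystem I) ∈ Submodule.span (PolyR n k)
        (Set.range (degIncl (gradeS n k) (inverseSystem I) d)) := by
      rw [hI.span_eq_top]
      trivial
    obtain ⟨c, hc⟩ := (Finsupp.mem_span_range_iff_exists_finsupp).mp h1
    have h2 : G = c.sum fun F r => r • ((F : gradeS n k d) : PolyS n k) := by
      refine (congrArg Subtype.val hc).symm.trans ?_
      rw [Finsupp.sum, AddSubmonoidClass.coe_finsetSum]
      rfl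
    rw [h2, Finsupp.sum, map_sum]
    exact Finset.sum_eq_zero fun F _ => hb _ F F.2
  let ψ : I →ₗ[PolyR n k] PolyR n k ⧸ I :=
    { toFun := fun u => -Submodule.Quotient.mk (a u)
      map_add' := fun u w => by
        rw [← neg_add, ← Submodule.Quotient.mk_add, neg_inj, Submodule.Quotient.eq]
        refine huniq _ fun v F hF => ?_
        rw [map_sub, map_add, LinearMap.sub_apply, LinearMap.add_apply, ← ha _ v F hF,
          ← ha _ v F hF, ← ha _ v F hF, Submodule.coe_add, map_add, LinearMap.add_apply, sub_self]
      map_smul' := fun r u => by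
        rw [RingHom.id_apply, smul_neg, ← Submodule.Quotient.mk_smul, neg_inj,
          Submodule.Quotient.eq]
        refine huniq _ fun v F hF => ?_
        have h1 : ((r • u : I) : PolyR n k) = u * r := mul_comm _ _
        have h2 : r • a u = a u * r := mul_comm _ _
        rw [map_sub, LinearMap.sub_apply, ← ha _ v F hF, h1, h2, pairRS_mul, pairRS_mul,
          ← mul_smul, ← mul_smul, ha _ (r * v) F hF, sub_self] }
  have hgr : ψ ∈ homZero (R := PolyR n k) (subGrade (gradeR n k) I) (quotGrade (gradeR n k) I) :=
    fun i u hu =>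
      (quotGrade (gradeR n k) I i).neg_mem (Submodule.mem_map_of_mem (hai u i hu))
  refine ⟨⟨ψ, hgr⟩, ?_⟩
  ext u
  apply degQuotIncl_injective
  rw [degQuotIncl_degComponent]
  change -Submodule.Quotient.mk (a (degIncl (gradeR n k) I d u)) =
    Submodule.Quotient.mk ((τ u : gradeR n k d) : PolyR n k)
  rw [neg_eq_iff_add_eq_zero, ← Submodule.Quotient.mk_add, Submodule.Quotient.mk_eq_zero]
  refine mem_of_pairRS_eq_zero hI.homogeneous (i := d)
    (add_mem (hai _ d u.1.2) (τ u).2) fun F hF hFd => ?_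
  have h1 := ha (degIncl (gradeR n k) I d u) 1 ⟨F, hFd⟩ hF
  have h2 := hτ u ⟨F, hFd⟩
  rw [one_smul, one_smul] at h1
  rw [map_add, LinearMap.add_apply]
  change _ + apolar n k d (τ u) ⟨F, hFd⟩ = 0
  rw [h2, ← h1]
  exact add_neg_cancel _

/-- The transpose of the degree `d` component of a homomorphism `I → R / I` extends. -/
theorem isExtendable_of_mem_range_ideal {σ : Module.End k (gradeS n k d)}
    {τ : Module.End k (gradeR n k d)}
    (hτ : ∀ u F, apolar n k d (τ u) F = -apolar n k d u (σ F))
    (h : (degPart (gradeR n k) I d).mkQ ∘ₗ τ ∘ₗ (degPart (gradeR n k) I d).subtype ∈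
      LinearMap.range (degComponent (gradeR n k) I d)) : IsExtendable I d σ := by
  obtain ⟨ψ, hψ⟩ := h
  intro i u hu hui
  obtain ⟨b, hb, hbu⟩ := ψ.2 i ⟨u, hu⟩ hui
  refine ⟨-b, neg_mem hb, fun j hij v hv F hF => ?_⟩
  have huv : u * v ∈ gradeR n k d := hij ▸ hui.mul hv
  let w : degPart (gradeR n k) I d := ⟨⟨u * v, huv⟩, I.mul_mem_right v hu⟩
  have h1 := degQuotIncl_degComponent (gradeR n k) I d ψ w
  rw [hψ] at h1
  have h2 : degIncl (gradeR n k) I d w = v • (⟨u, hu⟩ : I) := Subtype.ext (mul_comm u v)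
  rw [h2, map_smul, ← hbu] at h1
  change Submodule.Quotient.mk ((τ w : gradeR n k d) : PolyR n k) =
    v • (Submodule.Quotient.mk b : PolyR n k ⧸ I) at h1
  rw [← Submodule.Quotient.mk_smul, Submodule.Quotient.eq] at h1
  have h3 := mem_inverseSystem_iff.mp hF _ h1
  rw [map_sub, LinearMap.sub_apply, sub_eq_zero] at h3
  have h4 := hτ w F
  rw [apolar_apply, h3, smul_eq_mul, mul_comm, pairRS_mul] at h4
  rw [← pairRS_mul, map_neg, LinearMap.neg_apply, h4, neg_neg]
  rfl

end Extend

/-! ### The tangent space in the Grassmannian of subspaces of `S_d` -/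

section Locus

theorem exists_functional_factor {k A C W : Type*} [Field k] [AddCommGroup A] [Module k A]
    [AddCommGroup C] [Module k C] [AddCommGroup W] [Module k W] (p : A ⊗[k] C →ₗ[k] W)
    (g : A ⊗[k] C →ₗ[k] k) (h : ∀ z, p z = 0 → g z = 0) :
    ∃ f : Module.Dual k W, ∀ z, f (p z) = g z := by
  have h1 : g ∈ (LinearMap.ker p).dualAnnihilator :=
    (Submodule.mem_dualAnnihilator _).mpr fun z hz => h z hz
  rw [← LinearMap.range_dualMap_eq_dualAnnihilator_ker] at h1
  obtain ⟨f, rfl⟩ := h1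
  exact ⟨f, fun z => rfl⟩

variable {n : ℕ} {k : Type u} [Field k] {I : Ideal (PolyR n k)} {t d : ℕ}

theorem mem_levelLocus {h : ℕ → ℕ} {B : Type u} [CommRing B] [Algebra k B]
    (N : Module.Grassmannian B (B ⊗[k] gradeS n k d) (Module.finrank k (gradeS n k d) - t)) :
    N ∈ (levelLocus n k t d h).obj (CommAlgCat.of k B) ↔ ∀ (i : ℕ) (_ : 1 ≤ i) (hi : i < d),
      minorIdeal (productMap (contract n k hi.le) N.toSubmodule) (h i + 1) = ⊥ ∧
      minorIdeal (productMap (contract n k hi.le) N.toSubmodule) (h i) = ⊤ := by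
  refine (Set.ext_iff.mp (Subfunctor.iInf_obj
    (fun i : Set.Ico 1 d => rankLocus n k t i.2.2.le (h i)) (CommAlgCat.of k B)) N).trans
      (Set.mem_iInter.trans ?_)
  exact ⟨fun h i h1 h2 => h ⟨i, h1, h2⟩, fun h i => h i.1 i.2.1 i.2.2⟩

theorem IsArtinLevel.finrank_quotient (hI : IsArtinLevel I t d) :
    Module.finrank k (gradeR n k d ⧸ degPart (gradeR n k) I d) = t := by
  rw [(degQuotEquiv (gradeR n k) I d).finrank_eq]
  exact hI.type

variable [CharZero k]

theorem IsArtinLevel.finrank_prodSpan (hI : IsArtinLevel I t d) {i : ℕ} (hi : i ≤ d) :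
    Module.finrank k (prodSpan (contract n k hi) (degPart (gradeS n k) (inverseSystem I) d)) =
      hilbertFn I i := by
  rw [hI.prodSpan_eq hi, finrank_degPart_inverseSystem hI.homogeneous]

theorem IsArtinLevel.finrank_quotient_inverseSystem (hI : IsArtinLevel I t d) :
    Module.finrank k (gradeS n k d ⧸ degPart (gradeS n k) (inverseSystem I) d) =
      Module.finrank k (gradeS n k d) - t := by
  rw [Submodule.finrank_quotient, finrank_degPart_inverseSystem hI.homogeneous, hI.type]

/-- The minors condition on a first order deformation along `σ` says that a relation
`∑ u_j F_j = 0` in degree `i` implies `∑ u_j σ(F_j) ∈ I⁻¹`, so the functional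
`∑ u_j F_j ↦ ⟨u, ∑ u_j σ(F_j)⟩` is well defined on `(I⁻¹)_i` for `u ∈ I_i`. -/
theorem isExtendable_of_mem_levelLocus (hI : IsArtinLevel I t d)
    (N : Module.Grassmannian (DualNumber k) (DualNumber k ⊗[k] gradeS n k d)
      (Module.finrank k (gradeS n k d) - t))
    (hN : N ∈ (levelLocus n k t d (hilbertFn I)).obj (CommAlgCat.of k (DualNumber k)))
    (hN₀ : (Module.Grassmannian.map (TrivSqZeroExt.fstHom k k k) N).toSubmodule =
      (degPart (gradeS n k) (inverseSystem I) d).baseChange k)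
    (σ : Module.End k (gradeS n k d))
    (hσ : ∀ F ∈ degPart (gradeS n k) (inverseSystem I) d,
      (1 : DualNumber k) ⊗ₜ F + (DualNumber.eps : DualNumber k) ⊗ₜ σ F ∈ N.toSubmodule) :
    IsExtendable I d σ := by
  set Λ := degPart (gradeS n k) (inverseSystem I) d
  intro i u hu hui
  rcases Nat.eq_zero_or_pos i with rfl | hi0
  · refine ⟨0, zero_mem _, fun j _ v _ F _ => ?_⟩
    rw [hI.eq_zero_of_mem_gradeR_zero hu hui]
    simp
  rcases lt_trichotomy i d with hid | rfl | hid
  · -- `p` is the product `F ⊗ v ↦ v F`, and `q` is `F ⊗ v ↦ v σ(F)`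
    let p : Λ ⊗[k] gradeR n k (d - i) →ₗ[k] gradeS n k i :=
      TensorProduct.lift ((contract n k hid.le).flip ∘ₗ Λ.subtype)
    let q : Λ ⊗[k] gradeR n k (d - i) →ₗ[k] gradeS n k i :=
      TensorProduct.lift ((contract n k hid.le).flip ∘ₗ σ ∘ₗ Λ.subtype)
    let l : Λ →ₗ[k] N.toSubmodule :=
      (TensorProduct.mk k (DualNumber k) _ 1 ∘ₗ Λ.subtype +
        TensorProduct.mk k (DualNumber k) _ DualNumber.eps ∘ₗ σ ∘ₗ Λ.subtype).codRestrict
          (N.toSubmodule.restrictScalars k) (fun F => hσ F F.2)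
    have hl : ∀ z, productMap (contract n k hid.le) N.toSubmodule (LinearMap.rTensor _ l z) =
        (1 : DualNumber k) ⊗ₜ p z + (DualNumber.eps : DualNumber k) ⊗ₜ q z := by
      intro z
      induction z with
      | zero => simp
      | add x y hx hy =>
        simp only [map_add, hx, hy, tmul_add]
        abel
      | tmul F v =>
        rw [LinearMap.rTensor_tmul, productMap_tmul]
        change (contract n k hid.le v).baseChange (DualNumber k)
          (1 ⊗ₜ (F : gradeS n k d) + DualNumber.eps ⊗ₜ σ F) = _
        rw [map_add]
        rfl
    have hker : ∀ z, p z = 0 → (apolar n k i ⟨u, hui⟩ ∘ₗ q) z = 0 := by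
      intro z hz
      have h1 := hl z
      rw [hz, tmul_zero, zero_add] at h1
      have h2 := mem_prodSpan_of_minorIdeal_eq_bot (contract n k hid.le) N hN₀
        (by rw [hI.finrank_prodSpan]; exact ((mem_levelLocus N).mp hN i hi0 hid).1) _ h1
      rw [hI.prodSpan_eq] at h2
      exact mem_inverseSystem_iff.mp h2 u hu
    obtain ⟨f, hf⟩ := exists_functional_factor p (apolar n k i ⟨u, hui⟩ ∘ₗ q) hker
    obtain ⟨a, rfl⟩ := (apolar_bijective n k i).2 f
    refine ⟨a, a.2, fun j hj v hv F hF => ?_⟩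
    obtain rfl : j = d - i := by omega
    exact (hf (⟨F, hF⟩ ⊗ₜ ⟨v, hv⟩)).symm
  · obtain ⟨a, ha⟩ := (apolar_bijective n k i).2 (apolar n k i ⟨u, hui⟩ ∘ₗ σ)
    refine ⟨a, a.2, fun j hj v hv F _ => ?_⟩
    obtain rfl : j = 0 := by omega
    have h1 : v = coeff 0 v • 1 := by
      rw [smul_eq_C_mul, mul_one, ← homogeneousComponent_zero, homogeneousComponent_of_mem hv,
        if_pos rfl]
    have h2 : apolar n k i ⟨u, hui⟩ (σ F) = apolar n k i a F := (LinearMap.congr_fun ha F).symm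
    rw [h1, smul_assoc, smul_assoc, one_smul, one_smul, map_smul, map_smul]
    exact congrArg (coeff 0 v • ·) h2
  · exact ⟨0, zero_mem _, fun j hj => by omega⟩

/-- The deformations of `Λ` that come from homomorphisms `I⁻¹ → S / I⁻¹` extend to deformations of
all graded pieces of `I⁻¹`, so the ranks of the product maps do not jump. -/
theorem deformPoint_mem_levelLocus (hI : IsArtinLevel I t d) (σ₁ σ₂ : Module.End k (gradeS n k d))
    (h₁ : (degPart (gradeS n k) (inverseSystem I) d).mkQ ∘ₗ σ₁ ∘ₗ
      (degPart (gradeS n k) (inverseSystem I) d).subtype ∈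
        LinearMap.range (degComponent (gradeS n k) (inverseSystem I) d))
    (h₂ : (degPart (gradeS n k) (inverseSystem I) d).mkQ ∘ₗ σ₂ ∘ₗ
      (degPart (gradeS n k) (inverseSystem I) d).subtype ∈
        LinearMap.range (degComponent (gradeS n k) (inverseSystem I) d)) :
    deformPoint sqZeroPair_inr σ₁ σ₂ (degPart (gradeS n k) (inverseSystem I) d)
        hI.finrank_quotient_inverseSystem ∈
      (levelLocus n k t d (hilbertFn I)).obj (CommAlgCat.of k (TrivSqZeroExt k (k × k))) := by
  rw [mem_levelLocus]
  intro i _ hid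
  constructor
  · have key : ∀ σ : Module.End k (gradeS n k d),
        (degPart (gradeS n k) (inverseSystem I) d).mkQ ∘ₗ σ ∘ₗ
          (degPart (gradeS n k) (inverseSystem I) d).subtype ∈
            LinearMap.range (degComponent (gradeS n k) (inverseSystem I) d) →
        ∃ σ' : Module.End k (gradeS n k i), ∀ u,
          ∀ F ∈ degPart (gradeS n k) (inverseSystem I) d,
            contract n k hid.le u (σ F) - σ' (contract n k hid.le u F) ∈
              degPart (gradeS n k) (inverseSystem I) i := by
      rintro σ ⟨ψ, hψ⟩
      obtain ⟨σ', hσ'⟩ := exists_end_lift _ (degComponent (gradeS n k) (inverseSystem I) i ψ)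
      refine ⟨σ', fun u F hF => ?_⟩
      let G : degPart (gradeS n k) (inverseSystem I) i :=
        ⟨contract n k hid.le u F, (inverseSystem I).smul_mem (u : PolyR n k) hF⟩
      have e1 := degQuotIncl_degComponent (gradeS n k) (inverseSystem I) d ψ ⟨F, hF⟩
      have e2 := degQuotIncl_degComponent (gradeS n k) (inverseSystem I) i ψ G
      rw [hψ] at e1
      rw [← hσ'] at e2
      have e3 : degIncl (gradeS n k) (inverseSystem I) i G =
        (u : PolyR n k) • degIncl (gradeS n k) (inverseSystem I) d ⟨F, hF⟩ := rfl
      rw [e3, map_smul, ← e1] at e2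
      refine (Submodule.Quotient.eq (inverseSystem I)).mp ?_
      exact e2.symm
    obtain ⟨σ₁', h₁'⟩ := key σ₁ h₁
    obtain ⟨σ₂', h₂'⟩ := key σ₂ h₂
    rw [← finrank_degPart_inverseSystem hI.homogeneous]
    exact minorIdeal_deform_eq_bot sqZeroPair_inr _ _ _ σ₁ σ₂ σ₁' σ₂' _ rfl
      (fun u F hF => (inverseSystem I).smul_mem (u : PolyR n k) hF) h₁' h₂'
  · refine eq_top_of_map_eq_top (TrivSqZeroExt.fstHom k k (k × k)) ?_ _ ?_
    · intro x hx
      refine ⟨2, ?_⟩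
      have h1 : x = TrivSqZeroExt.inr x.snd := by
        ext
        · simpa using hx
        · simp
        · simp
      rw [h1, pow_two, TrivSqZeroExt.inr_mul_inr]
    · rw [eq_top_iff]
      refine le_trans ?_ (minorIdeal_le_map (TrivSqZeroExt.fstHom k k (k × k))
        (contract n k hid.le) _ _)
      rw [map_deformPoint (TrivSqZeroExt.fstHom k k (k × k)) sqZeroPair_inr sqZeroPair_zero
        (TrivSqZeroExt.fst_inr k (1, 0)) (TrivSqZeroExt.fst_inr k (0, 1))]
      have h1 : ∀ N : Submodule k (k ⊗[k] gradeS n k d),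
          N = (degPart (gradeS n k) (inverseSystem I) d).baseChange k →
          minorIdeal (productMap (contract n k hid.le) N) (hilbertFn I i) = ⊤ := by
        rintro _ rfl
        rw [← hI.finrank_prodSpan hid.le]
        exact minorIdeal_baseChange_eq_top _ _
      exact (h1 _ (deformPoint_zero_toSubmodule _ _ _ _)).ge

theorem tangentSpaceIsHomZero_inverseSystem (hI : IsArtinLevel I t d) :
    TangentSpaceIsHomZero (gradeS n k) (inverseSystem I) d
      (levelLocus n k t d (hilbertFn I)) := by
  refine tangentSpaceIsHomZero_of _ _ d hI.finrank_quotient_inverseSystem _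
    hI.degComponent_inverseSystem_injective ?_ ?_
  · intro N hN hN₀ τ hτ
    obtain ⟨σ, rfl⟩ := exists_end_lift _ τ
    refine (isExtendable_of_mem_levelLocus hI N hN hN₀ σ fun F hF => ?_).mem_range_inverseSystem hI
    exact (hτ ⟨F, hF⟩ (σ F)).mpr rfl
  · exact deformPoint_mem_levelLocus hI

end Locus

/-! ### The tangent space in the Grassmannian of subspaces of `R_d` -/

section Perp

/-- A point of the Grassmannian contains its double orthogonal. -/
theorem mem_of_forall_mem_perp {k V W B : Type*} [Field k] [AddCommGroup V] [Module k V]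
    [AddCommGroup W] [Module k W] [FiniteDimensional k W] [CommRing B] [Algebra k B]
    (p : V →ₗ[k] W →ₗ[k] k) (hp : Function.Bijective p) {c : ℕ}
    (N : Module.Grassmannian B (B ⊗[k] W) c) {x : B ⊗[k] W}
    (hx : ∀ y ∈ perp p N.toSubmodule, pairing B p y x = 0) : x ∈ N.toSubmodule := by
  -- a projective module has enough functionals, and those on the quotient by `N` come from `N^⊥`
  obtain ⟨s, hs⟩ := Module.projective_def.mp N.projective_quotient
  rw [← Submodule.Quotient.mk_eq_zero, ← hs (Submodule.Quotient.mk x)]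
  have : s (Submodule.Quotient.mk x) = 0 := by
    ext i
    obtain ⟨y, hy⟩ := (pairing_bijective p hp B).2
      (Finsupp.lapply i ∘ₗ s ∘ₗ N.toSubmodule.mkQ)
    have h1 := hx y fun F hF => by
      rw [hy, LinearMap.comp_apply, LinearMap.comp_apply, Submodule.mkQ_apply,
        (Submodule.Quotient.mk_eq_zero _).mpr hF, map_zero, map_zero]
    rw [hy] at h1
    exact h1
  rw [this, map_zero]

/-- If `τᵢ` is the negative transpose of `σᵢ`, then `1 + a τ₁ + b τ₂` is the inverse of the transpose
of `1 + a σ₁ + b σ₂`. -/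
theorem pairing_deformMap {k V W B : Type*} [Field k] [AddCommGroup V] [Module k V]
    [AddCommGroup W] [Module k W] [CommRing B] [Algebra k B] (p : V →ₗ[k] W →ₗ[k] k)
    {a b : B} (hab : SqZeroPair a b) {τ₁ τ₂ : Module.End k V} {σ₁ σ₂ : Module.End k W}
    (h₁ : ∀ u F, p (τ₁ u) F = -p u (σ₁ F)) (h₂ : ∀ u F, p (τ₂ u) F = -p u (σ₂ F))
    (x : B ⊗[k] V) (y : B ⊗[k] W) :
    pairing B p (deformMap a b τ₁ τ₂ x) (deformMap a b σ₁ σ₂ y) = pairing B p x y := by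
  induction x with
  | zero => simp
  | add x x' hx hx' => simp only [map_add, LinearMap.add_apply, hx, hx']
  | tmul c u =>
    induction y with
    | zero => simp
    | add y y' hy hy' => simp only [map_add, hy, hy']
    | tmul e F =>
      have haa := hab.left
      have hm := hab.mixed
      have hbb := hab.right
      simp only [deformMap_tmul, map_add, LinearMap.add_apply, pairing_tmul, h₁, h₂, map_neg]
      linear_combination
        (-c * e * algebraMap k B (p u (σ₁ (σ₁ F)))) * haa +
        (-c * e * (algebraMap k B (p u (σ₁ (σ₂ F))) + algebraMap k B (p u (σ₂ (σ₁ F))))) * hm +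
        (-c * e * algebraMap k B (p u (σ₂ (σ₂ F)))) * hbb

theorem exists_neg_transpose {k V W : Type*} [Field k] [AddCommGroup V] [Module k V]
    [AddCommGroup W] [Module k W] {p : V →ₗ[k] W →ₗ[k] k} (hp : Function.Bijective p)
    (σ : Module.End k W) : ∃ τ : Module.End k V, ∀ u F, p (τ u) F = -p u (σ F) := by
  let e := LinearEquiv.ofBijective p hp
  refine ⟨e.symm.toLinearMap ∘ₗ (-LinearMap.lcomp k k σ) ∘ₗ p, fun u F => ?_⟩
  have : p (e.symm (-(p u ∘ₗ σ))) = -(p u ∘ₗ σ) := e.apply_symm_apply _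
  exact LinearMap.congr_fun this F

variable {n : ℕ} {k : Type u} [Field k] [CharZero k] {I : Ideal (PolyR n k)} {t d : ℕ}

/-- `I_d` is the orthogonal of `Λ`, over every `k`-algebra. -/
theorem perp_baseChange_inverseSystem (hI : IsArtinLevel I t d) (B : Type u) [CommRing B]
    [Algebra k B] :
    perp (apolar n k d) ((degPart (gradeS n k) (inverseSystem I) d).baseChange B) =
      (degPart (gradeR n k) I d).baseChange B := by
  have h0 : SqZeroPair (0 : B) 0 := ⟨mul_zero _, mul_zero _, mul_zero _⟩
  apply le_antisymm
  · have h1 := perp_map (Algebra.ofId k B) (apolar n k d) (apolar_bijective n k d)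
      (deformPoint sqZeroPair_zero 0 0 (degPart (gradeS n k) (inverseSystem I) d)
        hI.finrank_quotient_inverseSystem)
    rw [map_deformPoint (Algebra.ofId k B) sqZeroPair_zero h0 (map_zero _) (map_zero _),
      deformPoint_zero_toSubmodule, deformPoint_toSubmodule] at h1
    have h2 : deformMap (0 : B) 0 (0 : Module.End k (gradeS n k d)) 0 = LinearMap.id := by
      simp [deformMap]
    rw [h2, Submodule.map_id] at h1
    rw [h1, Submodule.span_le]
    rintro _ ⟨y, hy, rfl⟩
    obtain ⟨u, rfl⟩ : ∃ u, y = (1 : k) ⊗ₜ u :=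
      ⟨TensorProduct.lid k _ y, ((TensorProduct.lid k _).symm_apply_apply y).symm⟩
    refine Submodule.tmul_mem_baseChange_of_mem _ ?_
    refine mem_of_pairRS_eq_zero hI.homogeneous u.2 fun F hF hFd => ?_
    have := hy ((1 : k) ⊗ₜ ⟨F, hFd⟩) (Submodule.tmul_mem_baseChange_of_mem 1 hF)
    simpa [apolar_apply] using this
  · rw [Submodule.baseChange_eq_span, Submodule.span_le]
    rintro _ ⟨u, hu, rfl⟩
    intro F hF
    rw [Submodule.baseChange_eq_span] at hF
    induction hF using Submodule.span_induction with
    | mem x hx =>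
      obtain ⟨F, hF, rfl⟩ := hx
      have : apolar n k d u F = 0 := mem_inverseSystem_iff.mp hF u hu
      simp [this]
    | zero => simp
    | add x y _ _ hx hy => rw [map_add, hx, hy, add_zero]
    | smul c x _ hx => rw [map_smul, hx, smul_zero]

theorem mem_levelLocusDual {h : ℕ → ℕ} {B : Type u} [CommRing B] [Algebra k B]
    (M : Module.Grassmannian B (B ⊗[k] gradeR n k d) t) :
    M ∈ (levelLocusDual n k t d h).obj (CommAlgCat.of k B) ↔
      ∃ N : Module.Grassmannian B (B ⊗[k] gradeS n k d) (Module.finrank k (gradeS n k d) - t),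
        N ∈ (levelLocus n k t d h).obj (CommAlgCat.of k B) ∧
          M.toSubmodule = perp (apolar n k d) N.toSubmodule := Iff.rfl

theorem tangentSpaceIsHomZero_ideal (hI : IsArtinLevel I t d) :
    TangentSpaceIsHomZero (gradeR n k) I d (levelLocusDual n k t d (hilbertFn I)) := by
  have hp := apolar_bijective n k d
  refine tangentSpaceIsHomZero_of _ _ d hI.finrank_quotient _ hI.degComponent_injective ?_ ?_
  · intro M hM hM₀ τ hτ
    obtain ⟨N, hN, hMN⟩ := (mem_levelLocusDual M).mp hM
    -- the specialization of `N` is the orthogonal of that of `M`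
    have hperp : perp (apolar n k d)
        (Module.Grassmannian.map (TrivSqZeroExt.fstHom k k k) N).toSubmodule =
          (degPart (gradeR n k) I d).baseChange k := by
      rw [perp_map _ _ hp, ← hMN, ← map_eq_span, hM₀]
    have hN₀ : (Module.Grassmannian.map (TrivSqZeroExt.fstHom k k k) N).toSubmodule =
        (degPart (gradeS n k) (inverseSystem I) d).baseChange k := by
      apply le_antisymm
      · intro y hy
        obtain ⟨F, rfl⟩ : ∃ F, y = (1 : k) ⊗ₜ F :=
          ⟨TensorProduct.lid k _ y, ((TensorProduct.lid k _).symm_apply_apply y).symm⟩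
        refine Submodule.tmul_mem_baseChange_of_mem _ ?_
        refine (mem_inverseSystem_iff_of_mem hI.homogeneous F.2).mpr fun u hu hud => ?_
        have h1 : (1 : k) ⊗ₜ (⟨u, hud⟩ : gradeR n k d) ∈ perp (apolar n k d)
            (Module.Grassmannian.map (TrivSqZeroExt.fstHom k k k) N).toSubmodule := by
          rw [hperp]
          exact Submodule.tmul_mem_baseChange_of_mem 1 hu
        have := h1 _ hy
        simpa [apolar_apply] using this
      · intro F hF
        refine mem_of_forall_mem_perp (apolar n k d) hp _ fun y hy => ?_
        rw [hperp, ← perp_baseChange_inverseSystem hI] at hy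
        exact hy F hF
    obtain ⟨ρ, hρ⟩ := exists_tangentHom N hN₀
    obtain ⟨σ, rfl⟩ := exists_end_lift _ ρ
    have hσ : ∀ F ∈ degPart (gradeS n k) (inverseSystem I) d,
        (1 : DualNumber k) ⊗ₜ F + (DualNumber.eps : DualNumber k) ⊗ₜ σ F ∈ N.toSubmodule :=
      fun F hF => (hρ ⟨F, hF⟩ (σ F)).mpr rfl
    obtain ⟨τ', hτ'⟩ := exists_neg_transpose hp σ
    have hτeq : τ = (degPart (gradeR n k) I d).mkQ ∘ₗ τ' ∘ₗ (degPart (gradeR n k) I d).subtype := by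
      ext u
      refine (hτ u (τ' u)).mp ?_
      rw [hMN]
      intro y hy
      obtain ⟨F, G, rfl⟩ := exists_dual_decomp y
      have hF := left_mem_of_dual_mem N hN₀ hy
      have hG : G - σ F ∈ degPart (gradeS n k) (inverseSystem I) d := by
        rw [← eps_tmul_mem_iff N hN₀]
        have := sub_mem hy (hσ F hF)
        rwa [add_sub_add_left_eq_sub, ← tmul_sub] at this
      have h1 : apolar n k d (u : gradeR n k d) F = 0 := mem_inverseSystem_iff.mp hF _ u.2
      have h2 : apolar n k d (u : gradeR n k d) (G - σ F) = 0 := mem_inverseSystem_iff.mp hG _ u.2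
      rw [map_sub, sub_eq_zero] at h2
      simp [h1, hτ', h2]
    rw [hτeq]
    exact (isExtendable_of_mem_levelLocus hI N hN hN₀ σ hσ).mem_range_ideal hI hτ'
  · intro τ₁ τ₂ h₁ h₂
    have hflip : ∀ τ : Module.End k (gradeR n k d), ∃ σ : Module.End k (gradeS n k d),
        ∀ u F, apolar n k d (τ u) F = -apolar n k d u (σ F) := by
      intro τ
      obtain ⟨σ, hσ⟩ := exists_neg_transpose (flip_bijective_of_bijective hp) τ
      exact ⟨σ, fun u F => by simpa [neg_eq_iff_eq_neg] using (congrArg (-·) (hσ F u)).symm⟩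
    obtain ⟨σ₁, hσ₁⟩ := hflip τ₁
    obtain ⟨σ₂, hσ₂⟩ := hflip τ₂
    refine (mem_levelLocusDual _).mpr ⟨_, deformPoint_mem_levelLocus hI σ₁ σ₂
      ((isExtendable_of_mem_range_ideal hσ₁ h₁).mem_range_inverseSystem hI)
      ((isExtendable_of_mem_range_ideal hσ₂ h₂).mem_range_inverseSystem hI), ?_⟩
    rw [deformPoint_toSubmodule, deformPoint_toSubmodule]
    ext x
    obtain ⟨x, rfl⟩ := (deformEquiv sqZeroPair_inr τ₁ τ₂).surjective x
    have hx : deformEquiv sqZeroPair_inr τ₁ τ₂ x ∈ ((degPart (gradeR n k) I d).baseChange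
        (TrivSqZeroExt k (k × k))).map (deformMap _ _ τ₁ τ₂) ↔
        x ∈ (degPart (gradeR n k) I d).baseChange (TrivSqZeroExt k (k × k)) :=
      ⟨fun ⟨y, hy, hyx⟩ => (deformEquiv sqZeroPair_inr τ₁ τ₂).injective hyx ▸ hy,
        fun h => ⟨x, h, rfl⟩⟩
    rw [hx, ← perp_baseChange_inverseSystem hI]
    constructor
    · rintro h _ ⟨y, hy, rfl⟩
      exact (pairing_deformMap _ sqZeroPair_inr hσ₁ hσ₂ x y).trans (h y hy)
    · intro h y hy
      exact (pairing_deformMap _ sqZeroPair_inr hσ₁ hσ₂ x y).symm.trans (h _ ⟨y, hy, rfl⟩)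

end Perp

/-! ### Homomorphisms and the square of the ideal -/

section Square

variable {n : ℕ} {k : Type u} [Field k] (I : Ideal (PolyR n k))

theorem inverseSystem_le_inverseSystem_sq : inverseSystem I ≤ inverseSystem (I ^ 2) :=
  fun _ hF => mem_inverseSystem.mpr fun u hu =>
    mem_inverseSystem.mp hF u (Ideal.pow_le_self two_ne_zero hu)

theorem sqQuotientIncl_injective : Function.Injective (sqQuotientIncl I) := by
  rw [injective_iff_map_eq_zero]
  intro x hx
  obtain ⟨F, rfl⟩ := Submodule.Quotient.mk_surjective _ x
  have h1 : (F : PolyS n k) ∈ inverseSystem I := (Submodule.Quotient.mk_eq_zero _).mp hx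
  exact (Submodule.Quotient.mk_eq_zero _).mpr h1

theorem mem_sqQuotientGrade_iff {i : ℕ} {x : SqQuotient I} :
    x ∈ sqQuotientGrade I i ↔ sqQuotientIncl I x ∈ quotGrade (gradeS n k) (inverseSystem I) i := by
  constructor
  · rintro ⟨F, hF, rfl⟩
    exact ⟨F, hF, rfl⟩
  · rintro ⟨F, hF, hFx⟩
    obtain ⟨G, rfl⟩ := Submodule.Quotient.mk_surjective _ x
    have h1 : F - G ∈ inverseSystem I := (Submodule.Quotient.eq _).mp hFx
    have h2 : F ∈ inverseSystem (I ^ 2) := by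
      have := add_mem (inverseSystem_le_inverseSystem_sq I h1) G.2
      rwa [sub_add_cancel] at this
    refine ⟨⟨F, h2⟩, hF, ?_⟩
    exact (Submodule.Quotient.eq _).mpr h1

theorem smul_mem_inverseSystem_iff {F : PolyS n k} :
    (∀ u ∈ I, u • F ∈ inverseSystem I) ↔ F ∈ inverseSystem (I ^ 2) := by
  constructor
  · intro h
    refine mem_inverseSystem.mpr fun w hw => ?_
    rw [pow_two] at hw
    induction hw using Submodule.mul_induction_on' with
    | mem_mul_mem u hu v hv =>
      rw [mul_smul]
      exact mem_inverseSystem.mp (h v hv) u hu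
    | add x _ y _ hx hy => rw [add_smul, hx, hy, add_zero]
  · intro h u hu
    refine mem_inverseSystem.mpr fun v hv => ?_
    rw [← mul_smul]
    exact mem_inverseSystem.mp h _ (by rw [pow_two]; exact Ideal.mul_mem_mul hv hu)

/-- A homomorphism `I⁻¹ → S / I⁻¹` has values in the elements killed by `I`, as `I I⁻¹ = 0`. -/
theorem exists_equiv_sqQuotient :
    ∃ e : homZero (R := PolyR n k) (subGrade (gradeS n k) (inverseSystem I)) (sqQuotientGrade I)
        ≃ₗ[k] homZero (R := PolyR n k) (subGrade (gradeS n k) (inverseSystem I))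
          (quotGrade (gradeS n k) (inverseSystem I)),
      ∀ ψ, (e ψ).1 = sqQuotientIncl I ∘ₗ ψ.1 := by
  let f : homZero (R := PolyR n k) (subGrade (gradeS n k) (inverseSystem I)) (sqQuotientGrade I)
      →ₗ[k] homZero (R := PolyR n k) (subGrade (gradeS n k) (inverseSystem I))
        (quotGrade (gradeS n k) (inverseSystem I)) :=
    { toFun := fun ψ => ⟨sqQuotientIncl I ∘ₗ ψ.1, fun i F hF =>
        (mem_sqQuotientGrade_iff I).mp (ψ.2 i F hF)⟩
      map_add' := fun ψ ψ' => Subtype.ext (LinearMap.comp_add _ _ _)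
      map_smul' := fun c ψ => Subtype.ext (LinearMap.ext fun F =>
        ((sqQuotientIncl I).restrictScalars k).map_smul c (ψ.1 F)) }
  have hf : Function.Injective f := by
    intro ψ ψ' h
    refine Subtype.ext (LinearMap.ext fun F => sqQuotientIncl_injective I ?_)
    exact LinearMap.congr_fun (congrArg Subtype.val h) F
  have hf' : Function.Surjective f := by
    intro φ
    have hr : ∀ F, φ.1 F ∈ LinearMap.range (sqQuotientIncl I) := by
      intro F
      obtain ⟨G, hG⟩ := Submodule.Quotient.mk_surjective _ (φ.1 F)
      have h1 : G ∈ inverseSystem (I ^ 2) := by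
        rw [← smul_mem_inverseSystem_iff]
        intro u hu
        have h2 : u • F = 0 := Subtype.ext (mem_inverseSystem.mp F.2 u hu)
        rw [← Submodule.Quotient.mk_eq_zero, Submodule.Quotient.mk_smul, hG, ← map_smul, h2,
          map_zero]
      exact ⟨Submodule.Quotient.mk ⟨G, h1⟩, hG⟩
    let e := LinearEquiv.ofInjective (sqQuotientIncl I) (sqQuotientIncl_injective I)
    have he : ∀ F, sqQuotientIncl I (e.symm ⟨φ.1 F, hr F⟩) = φ.1 F := fun F =>
      congrArg Subtype.val (e.apply_symm_apply ⟨φ.1 F, hr F⟩)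
    refine ⟨⟨e.symm.toLinearMap ∘ₗ φ.1.codRestrict _ hr, fun i F hF => ?_⟩, ?_⟩
    · refine (mem_sqQuotientGrade_iff I).mpr ?_
      have := φ.2 i F hF
      rw [← he F] at this
      exact this
    · exact Subtype.ext (LinearMap.ext he)
  exact ⟨LinearEquiv.ofBijective f ⟨hf, hf'⟩, fun ψ => rfl⟩

/-- A homomorphism `I → R / I` kills `I²`, as `I` annihilates `R / I`. -/
theorem exists_equiv_cotangent :
    ∃ e : homZero (R := PolyR n k) (cotangentGrade I) (quotGrade (gradeR n k) I)
        ≃ₗ[k] homZero (R := PolyR n k) (subGrade (gradeR n k) I) (quotGrade (gradeR n k) I),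
      ∀ ψ, (e ψ).1 = ψ.1 ∘ₗ I.toCotangent := by
  let f : homZero (R := PolyR n k) (cotangentGrade I) (quotGrade (gradeR n k) I)
      →ₗ[k] homZero (R := PolyR n k) (subGrade (gradeR n k) I) (quotGrade (gradeR n k) I) :=
    { toFun := fun ψ => ⟨ψ.1 ∘ₗ I.toCotangent, fun i u hu =>
        ψ.2 i _ (Submodule.mem_map_of_mem hu)⟩
      map_add' := fun ψ ψ' => rfl
      map_smul' := fun c ψ => rfl }
  have hf : Function.Injective f := by
    intro ψ ψ' h
    refine Subtype.ext (LinearMap.ext fun x => ?_)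
    obtain ⟨u, rfl⟩ := I.toCotangent_surjective x
    exact LinearMap.congr_fun (congrArg Subtype.val h) u
  have hf' : Function.Surjective f := by
    intro φ
    have hker : I • (⊤ : Submodule (PolyR n k) I) ≤ LinearMap.ker φ.1 := by
      refine Submodule.smul_le.mpr fun u hu w _ => ?_
      obtain ⟨b, hb⟩ := Submodule.Quotient.mk_surjective _ (φ.1 w)
      rw [LinearMap.mem_ker, map_smul, ← hb, ← Submodule.Quotient.mk_smul,
        Submodule.Quotient.mk_eq_zero]
      exact I.mul_mem_right b hu
    let ψ : I.Cotangent →ₗ[PolyR n k] PolyR n k ⧸ I :=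
      (I • (⊤ : Submodule (PolyR n k) I)).liftQ φ.1 hker
    refine ⟨⟨ψ, ?_⟩, Subtype.ext (LinearMap.ext fun u => rfl)⟩
    rintro i _ ⟨u, hu, rfl⟩
    exact φ.2 i u hu
  exact ⟨LinearEquiv.ofBijective f ⟨hf, hf'⟩, fun ψ => rfl⟩

end Square

end

end LevelAlgebra

theorem mainTheorem2 {k : Type*} [Field k] [IsAlgClosed k] [CharZero k] (n t d : ℕ) (h : ℕ → ℕ)
    (I : Ideal (PolyR n k)) (hI : IsArtinLevel I t d) (hh : ∀ i, hilbertFn I i = h i) :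
    (TangentSpaceIsHomZero (gradeS n k) (inverseSystem I) d (levelLocus n k t d h) ∧
      ∃ e : homZero (R := PolyR n k) (subGrade (gradeS n k) (inverseSystem I)) (sqQuotientGrade I)
          ≃ₗ[k] homZero (R := PolyR n k) (subGrade (gradeS n k) (inverseSystem I))
            (quotGrade (gradeS n k) (inverseSystem I)),
        ∀ ψ, (e ψ).1 = sqQuotientIncl I ∘ₗ ψ.1) ∧
    (TangentSpaceIsHomZero (gradeR n k) I d (levelLocusDual n k t d h) ∧
      ∃ e : homZero (R := PolyR n k) (cotangentGrade I) (quotGrade (gradeR n k) I)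
          ≃ₗ[k] homZero (R := PolyR n k) (subGrade (gradeR n k) I) (quotGrade (gradeR n k) I),
        ∀ ψ, (e ψ).1 = ψ.1 ∘ₗ I.toCotangent) := by
  obtain rfl : hilbertFn I = h := funext hh
  exact ⟨⟨tangentSpaceIsHomZero_inverseSystem hI, exists_equiv_sqQuotient I⟩,
    tangentSpaceIsHomZero_ideal hI, exists_equiv_cotangent I⟩
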